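/- All graphs are finite and simple. For a graph $G$ let $m_k(G)$ be the number of matchings of $G$ with exactly $k$ edges and $i_k(G)$ the number of independent sets of $G$ with exactly $k$ vertices, and put $\log 0=-\infty$. For an integer $d\ge 1$ and $n$ divisible by $2d$, let $H_{d,n}$ be the disjoint union of $n/(2d)$ copies of the complete bipartite graph $K_{d,d}$. For a sequence $\mathcal G=(G_j)_{j\ge 0}$ of $d$-regular graphs whose numbers of vertices $n_j=|V(G_j)|$ tend to infinity, and for $\rho\in[0,1/2]$, the $\rho$-monomer entropy and the independent set entropy of $\mathcal G$ are $$h_{\mathcal G}(\rho)=\sup_{(k_j)}\ \limsup_{j\to\infty}\frac{\log m_{k_j}(G_j)}{n_j},\qquad h^{\mathrm{ind}}_{\mathcal G}(\rho)=\sup_{(k_j)}\ \limsup_{j\to\infty}\frac{\log i_{k_j}(G_j)}{n_j},$$ where both suprema are over all sequences $(k_j)$ of nonnegative integers with $k_j/n_j\to\rho$. Theorem (asymptotic upper matching conjecture of Friedland, Krop, Lundow and Markström, and its analogue for independent sets). Let $d\ge 1$ be an integer and $\rho\in[0,1/2]$. The limits $$h_d(\rho)=\lim_{\substack{n\to\infty\\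 2d\mid n}}\frac{\log m_{\lfloor \rho n\rfloor}(H_{d,n})}{n},\qquad h^{\mathrm{ind}}_d(\rho)=\lim_{\substack{n\to\infty\\ 2d\mid n}}\frac{\log i_{\lfloor \rho n\rfloor}(H_{d,n})}{n}$$ exist and are finite, and for every sequence $\mathcal G$ of $d$-regular graphs whose numbers of vertices tend to infinity, $$h_{\mathcal G}(\rho)\le h_d(\rho)\qquad\text{and}\qquad h^{\mathrm{ind}}_{\mathcal G}(\rho)\le h^{\mathrm{ind}}_d(\rho).$$ -/

import Mathlib

open Filter Topology

namespace RegularEntropy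

/-- `m_k(G)`: the number of matchings of `G` with exactly `k` edges. A matching is a subgraph all
of whose vertices have exactly one neighbour in it, so it is determined by its set of edges. -/
noncomputable def numMatchings {V : Type*} (G : SimpleGraph V) (k : ℕ) : ℕ :=
  {M : G.Subgraph | M.IsMatching ∧ M.edgeSet.ncard = k}.ncard

/-- `i_k(G)`: the number of independent sets of `G` with exactly `k` vertices. -/
noncomputable def numIndepSets {V : Type*} (G : SimpleGraph V) (k : ℕ) : ℕ :=
  {s : Finset V | G.IsNIndepSet k s}.ncard

/-- The graph `H_{d,n}`: the disjoint union of `n / (2d)` copies of `K_{d,d}`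
(meant for `d ≥ 1` and `n` divisible by `2d`). The first coordinate names the copy. -/
def unionKdd (d n : ℕ) : SimpleGraph (Fin (n / (2 * d)) × (Fin d ⊕ Fin d)) where
  Adj x y := x.1 = y.1 ∧ (completeBipartiteGraph (Fin d) (Fin d)).Adj x.2 y.2
  symm := ⟨fun _ _ h => ⟨h.1.symm, h.2.symm⟩⟩
  loopless := ⟨fun _ h => h.2.ne rfl⟩

/-- `(log a) / n` as an extended real number, with `log 0 = -∞`. -/
noncomputable def logRate (a n : ℕ) : EReal :=
  ENNReal.log (a : ENNReal) / (n : EReal)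

/-- The `ρ`-monomer entropy of a sequence of finite graphs: the supremum, over all integer
sequences `k` with `k j / |V (G j)| → ρ`, of `limsup (log m_{k j}(G j)) / |V (G j)|`. -/
noncomputable def monomerEntropy {V : ℕ → Type*} [∀ j, Fintype (V j)]
    (G : ∀ j, SimpleGraph (V j)) (ρ : ℝ) : EReal :=
  ⨆ (k : ℕ → ℕ) (_ : Tendsto (fun j => (k j : ℝ) / (Fintype.card (V j) : ℝ)) atTop (𝓝 ρ)),
    limsup (fun j => logRate (numMatchings (G j) (k j)) (Fintype.card (V j))) atTop

/-- The independent set entropy of a sequence of finite graphs at density `ρ`: the supremum, over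
all integer sequences `k` with `k j / |V (G j)| → ρ`, of
`limsup (log i_{k j}(G j)) / |V (G j)|`. -/
noncomputable def indepSetEntropy {V : ℕ → Type*} [∀ j, Fintype (V j)]
    (G : ∀ j, SimpleGraph (V j)) (ρ : ℝ) : EReal :=
  ⨆ (k : ℕ → ℕ) (_ : Tendsto (fun j => (k j : ℝ) / (Fintype.card (V j) : ℝ)) atTop (𝓝 ρ)),
    limsup (fun j => logRate (numIndepSets (G j) (k j)) (Fintype.card (V j))) atTop

/-- `n → ∞` along the integers divisible by `2d`. -/
def atTopDvd (d : ℕ) : Filter ℕ := atTop ⊓ 𝓟 {n | 2 * d ∣ n}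

end RegularEntropy

/-! Let `P` be the generating polynomial of matchings (or of independent sets) of a `d`-regular
graph on `n` vertices, and `p` that of `K_{d,d}`. The core is `P(x) ≤ p(x)^(n/(2d))` for all `x >
0`. A single term of `P` is at most `P(x)`, so `(log m_k)/n ≤ log p(x)/(2d) - (k/n) log x`.
Optimizing over `x` bounds the entropy by `h/(2d)`, where `h = inf_x (log p(x) - μ log x)` and `μ =
2dρ`. For `N` copies of `K_{d,d}` the polynomial is `p^N`, and its coefficient at `⌊μN⌋` grows at
exactly the rate `h` (`exists_growth_rate`): tilt by `x` until the mean is `μ`, then apply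
Chebyshev's inequality.

The comparison of polynomials is the occupancy method: integrate `x P'/P ≤ (n/(2d)) x p'/p`, an
inequality between the mean sizes of random configurations.

For independent sets, condition on the set away from the closed neighbourhood of a vertex `u`. What
may be added inside the neighbourhood is a lower set, and among lower sets the full power set is
extremal (`sum_card_mul_pow_le_of_lowerSet`). Summing over `u` gives the bound.

For matchings, look at an edge `uv` and a matching avoiding both ends, with `a` and `b` free
neighbours at the ends, `K` of them common. Counting in two ways gives linear identities
(`sum_localConstraint_eq_zero`), and the bound follows by linear programming duality. The dual
variables solve a recursion making the slack vanish for `a = b`, `K = 0`, the only data seen in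
`K_{d,d}` (`dualSeq_closes`). The slack is nonpositive for all other data because the solution is
monotone (`dual_recursion_mono`). -/

namespace RegularEntropy

open Polynomial

/-! ### Coefficients of powers of a polynomial: moments and concentration -/

section Coefficients

variable {p : ℝ[X]} {d : ℕ}

theorem coeff_mul_coeff_le {p q : ℝ[X]} (hp : ∀ i, 0 ≤ p.coeff i) (hq : ∀ i, 0 ≤ q.coeff i)
    (i j : ℕ) : p.coeff i * q.coeff j ≤ (p * q).coeff (i + j) := by
  rw [coeff_mul]
  exact Finset.single_le_sum (f := fun x : ℕ × ℕ => p.coeff x.1 * q.coeff x.2)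
    (fun x _ => mul_nonneg (hp _) (hq _)) (a := (i, j)) (by simp)

theorem coeff_mul_nonneg {p q : ℝ[X]} (hp : ∀ i, 0 ≤ p.coeff i) (hq : ∀ i, 0 ≤ q.coeff i)
    (k : ℕ) : 0 ≤ (p * q).coeff k := by
  rw [coeff_mul]
  exact Finset.sum_nonneg fun x _ => mul_nonneg (hp _) (hq _)

theorem coeff_pow_nonneg (hp : ∀ i, 0 ≤ p.coeff i) (N k : ℕ) : 0 ≤ (p ^ N).coeff k := by
  induction N generalizing k with
  | zero => rw [pow_zero, coeff_one]; split_ifs <;> norm_num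
  | succ N ih => rw [pow_succ]; exact coeff_mul_nonneg (ih ·) hp k

/-- Lets a few spare factors of `p` shift an index without decreasing the coefficient. -/
theorem one_le_coeff_pow (hp : ∀ i, 0 ≤ p.coeff i) (h1 : ∀ i ≤ d, 1 ≤ p.coeff i) (N : ℕ) :
    ∀ r ≤ d * N, 1 ≤ (p ^ N).coeff r := by
  induction N with
  | zero => intro r hr; obtain rfl : r = 0 := by omega
            simp
  | succ N ih =>
    intro r hr
    rw [mul_add, mul_one] at hr
    obtain ⟨a, b, rfl, ha, hb⟩ : ∃ a b, a + b = r ∧ a ≤ d * N ∧ b ≤ d :=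
      ⟨min r (d * N), r - min r (d * N), by omega, by omega, by omega⟩
    rw [pow_succ]
    exact (one_le_mul_of_one_le_of_one_le (ih a ha) (h1 b hb)).trans
      (coeff_mul_coeff_le (coeff_pow_nonneg hp N) hp a b)

theorem eval_eq_sum_coeff {n : ℕ} (hd : p.natDegree ≤ n) (x : ℝ) :
    p.eval x = ∑ k ∈ Finset.range (n + 1), p.coeff k * x ^ k :=
  eval_eq_sum_range' (by omega) x

theorem coeff_mul_pow_le_eval (hp : ∀ i, 0 ≤ p.coeff i) {x : ℝ} (hx : 0 ≤ x) (k : ℕ) :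
    p.coeff k * x ^ k ≤ p.eval x := by
  rw [eval_eq_sum_coeff (n := max p.natDegree k) (le_max_left _ _)]
  exact Finset.single_le_sum (f := fun k => p.coeff k * x ^ k)
    (fun i _ => mul_nonneg (hp i) (pow_nonneg hx _)) (by simp)

theorem eval_pos_of_coeff_nonneg (hp : ∀ i, 0 ≤ p.coeff i) (h0 : 0 < p.coeff 0) {x : ℝ}
    (hx : 0 ≤ x) : 0 < p.eval x := by
  have := coeff_mul_pow_le_eval hp hx 0
  simp at this
  linarith

theorem mul_derivative_eval {n : ℕ} (hd : p.natDegree ≤ n) (x : ℝ) :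
    x * p.derivative.eval x = ∑ k ∈ Finset.range (n + 1), (k : ℝ) * (p.coeff k * x ^ k) := by
  rw [derivative_eval, sum_over_range' _ (by simp) (n + 1) (by omega), Finset.mul_sum]
  refine Finset.sum_congr rfl fun k _ => ?_
  cases k with
  | zero => simp
  | succ k => push_cast; simp only [pow_succ]; ring

theorem sum_sq_mul_coeff {n : ℕ} (hd : p.natDegree ≤ n) (x : ℝ) :
    ∑ k ∈ Finset.range (n + 1), (k : ℝ) ^ 2 * (p.coeff k * x ^ k) =
      x * p.derivative.eval x + x ^ 2 * p.derivative.derivative.eval x := by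
  have hc : ∀ k, (X * p.derivative).coeff k = k * p.coeff k := fun k => by
    cases k with
    | zero => simp
    | succ k => rw [coeff_X_mul, coeff_derivative]; push_cast; ring
  have h := mul_derivative_eval (p := X * p.derivative) (n := n)
    (natDegree_le_iff_coeff_eq_zero.2 fun k hk => by
      rw [hc, coeff_eq_zero_of_natDegree_lt (by omega), mul_zero]) x
  simp only [derivative_mul, derivative_X, one_mul, eval_add, eval_mul, eval_X, hc] at h
  calc _ = ∑ k ∈ Finset.range (n + 1), (k : ℝ) * (k * p.coeff k * x ^ k) :=
        Finset.sum_congr rfl fun k _ => by ring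
    _ = _ := by rw [← h]; ring

/-- Unnormalized variance of a sum of `N` independent variables, each with law proportional to `p_k
x ^ k` on `{0, ..., d}` and mean `μ`; one such variable has variance at most `d ^ 2`. -/
theorem variance_pow_le (hd : p.natDegree ≤ d) (hp : ∀ i, 0 ≤ p.coeff i) {x μ : ℝ} (hx : 0 ≤ x)
    (hμ : μ ≤ d) (h : x * p.derivative.eval x = μ * p.eval x) (N : ℕ) :
    ∑ k ∈ Finset.range (d * N + 1), ((k : ℝ) - μ * N) ^ 2 * ((p ^ N).coeff k * x ^ k) ≤
      N * d ^ 2 * p.eval x ^ N := by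
  have hq : (p ^ N).natDegree ≤ d * N := natDegree_pow_le.trans (by rw [mul_comm]; gcongr)
  have e0 := eval_eq_sum_coeff hq x
  have e1 := mul_derivative_eval hq x
  have e2 := sum_sq_mul_coeff hq x
  have hP : 0 ≤ p.eval x :=
    (mul_nonneg (hp 0) (pow_nonneg hx 0)).trans (coeff_mul_pow_le_eval hp hx 0)
  -- On the support `k ^ 2 ≤ d * k`, so the second factorial moment is at most `d - 1` times the
  -- mean.
  have hpp : x ^ 2 * p.derivative.derivative.eval x ≤ (d - 1) * μ * p.eval x := by
    have f1 := mul_derivative_eval hd x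
    have f2 := sum_sq_mul_coeff hd x
    have : ∑ k ∈ Finset.range (d + 1), (k : ℝ) ^ 2 * (p.coeff k * x ^ k) ≤
        d * ∑ k ∈ Finset.range (d + 1), (k : ℝ) * (p.coeff k * x ^ k) := by
      rw [Finset.mul_sum]
      refine Finset.sum_le_sum fun k hk => ?_
      have hk' : (k : ℝ) ≤ d := by exact_mod_cast Nat.lt_succ_iff.1 (Finset.mem_range.1 hk)
      have := mul_nonneg (hp k) (pow_nonneg hx k)
      rw [sq, mul_assoc]
      gcongr
    rw [f2, ← f1, h] at this
    linarith
  have hsum : ∑ k ∈ Finset.range (d * N + 1), ((k : ℝ) - μ * N) ^ 2 * ((p ^ N).coeff k * x ^ k) =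
      (x * (p ^ N).derivative.eval x + x ^ 2 * (p ^ N).derivative.derivative.eval x)
      - 2 * (μ * N) * (x * (p ^ N).derivative.eval x) + (μ * N) ^ 2 * (p ^ N).eval x := by
    rw [← e2, e1, e0, Finset.mul_sum, Finset.mul_sum, ← Finset.sum_sub_distrib,
      ← Finset.sum_add_distrib]
    exact Finset.sum_congr rfl fun k _ => by ring
  rw [hsum]
  -- The second derivative of `p ^ N` involves the exponent `N - 2`, so `N = 0` and `N = 1` are
  -- separate.
  rcases N with _ | _ | N
  · simp
  · simp only [zero_add, pow_one, Nat.cast_one]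
    have : μ * p.eval x ≤ d * p.eval x := by gcongr
    nlinarith [mul_nonneg (Nat.cast_nonneg (α := ℝ) d) (sub_nonneg.2 this),
      mul_nonneg (sq_nonneg μ) hP]
  · have hderiv : x * (p ^ (N + 2)).derivative.eval x = (N + 2) * μ * p.eval x ^ (N + 2) := by
      rw [derivative_pow]
      simp only [eval_mul, eval_C, eval_pow]
      push_cast
      calc _ = (N + 2) * p.eval x ^ (N + 1) * (x * p.derivative.eval x) := by
            ring
        _ = _ := by rw [h]; ring
    have hderiv2 : x ^ 2 * (p ^ (N + 2)).derivative.derivative.eval x =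
        (N + 2) * (N + 1) * μ ^ 2 * p.eval x ^ (N + 2) +
        (N + 2) * p.eval x ^ (N + 1) * (x ^ 2 * p.derivative.derivative.eval x) := by
      rw [derivative_pow]
      simp only [derivative_mul, derivative_pow, derivative_C, eval_add, eval_mul, eval_C,
        eval_pow, zero_mul, zero_add]
      rw [show N + 2 - 1 = N + 1 by omega, show N + 1 - 1 = N by omega]
      push_cast
      calc _ = (N + 2) * (N + 1) * p.eval x ^ N * (x * p.derivative.eval x) ^ 2 +
            (N + 2) * p.eval x ^ (N + 1) * (x ^ 2 * p.derivative.derivative.eval x) := by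
            ring
        _ = _ := by rw [h]; ring
    rw [hderiv, hderiv2, eval_pow]
    push_cast
    have hc : 0 ≤ (N + 2) * p.eval x ^ (N + 1) := by positivity
    have h1 := mul_le_mul_of_nonneg_left hpp hc
    have : μ * p.eval x ≤ d * p.eval x := by gcongr
    have h2 : (μ - μ ^ 2 + (d - 1) * μ) * p.eval x ≤ d ^ 2 * p.eval x := by
      nlinarith [mul_nonneg (Nat.cast_nonneg (α := ℝ) d) (sub_nonneg.2 this),
        mul_nonneg (sq_nonneg μ) hP]
    have h3 := mul_le_mul_of_nonneg_left h2 hc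
    rw [show N + 1 + 1 = N + 2 from rfl, show p.eval x ^ (N + 2) = p.eval x ^ (N + 1) * p.eval x
      from pow_succ _ _]
    linear_combination h1 + h3

/-- `X p' - μ p` has coefficients `(k - μ) p_k`: it is negative at `0` and its leading coefficient
is positive, so it has a positive root. -/
theorem exists_mean_eq (hd : p.natDegree ≤ d) (h0 : 0 < p.coeff 0) (h1 : 0 < p.coeff d) {μ : ℝ}
    (hμ0 : 0 < μ) (hμd : μ < d) : ∃ x > 0, x * p.derivative.eval x = μ * p.eval x := by
  set r : ℝ[X] := X * p.derivative - C μ * p with hr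
  have hc : ∀ k, r.coeff k = (k - μ) * p.coeff k := fun k => by
    rw [hr, coeff_sub, coeff_C_mul]
    cases k with
    | zero => simp
    | succ k => rw [coeff_X_mul, coeff_derivative]; push_cast; ring
  have hrd : r.natDegree ≤ d := natDegree_le_iff_coeff_eq_zero.2 fun k hk => by
    rw [hc, coeff_eq_zero_of_natDegree_lt (by omega), mul_zero]
  have hlead : 0 < r.coeff d := by rw [hc]; exact mul_pos (by linarith) h1
  have hnat : r.natDegree = d := natDegree_eq_of_le_of_coeff_ne_zero hrd hlead.ne'
  have hdpos : 0 < d := by exact_mod_cast hμ0.trans hμd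
  have ht := r.tendsto_atTop_of_leadingCoeff_nonneg (natDegree_pos_iff_degree_pos.1 (hnat ▸ hdpos))
    (by rw [leadingCoeff, hnat]; exact hlead.le)
  obtain ⟨y, hy0, hy⟩ := ((eventually_gt_atTop (0 : ℝ)).and (ht.eventually_ge_atTop 0)).exists
  have hr0 : r.eval 0 < 0 := by
    rw [← coeff_zero_eq_eval_zero, hc]; push_cast; nlinarith
  obtain ⟨x, hx, hx'⟩ := intermediate_value_Icc hy0.le r.continuous.continuousOn ⟨hr0.le, hy⟩
  refine ⟨x, lt_of_le_of_ne hx.1 ?_, ?_⟩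
  · rintro rfl; linarith
  · simp only [hr, eval_sub, eval_mul, eval_X, eval_C] at hx'
    linarith

/-- By Chebyshev at most a quarter of the mass lies outside the window of radius `2d√N`. If every
term inside were below `1 / (2(dN + 1))` of the total, the at most `dN + 1` terms inside would carry
less than half of it, a contradiction. -/
theorem exists_large_term (hd : p.natDegree ≤ d) (hp : ∀ i, 0 ≤ p.coeff i) (h0 : 0 < p.coeff 0)
    (hd1 : 1 ≤ d) {x μ : ℝ} (hx : 0 ≤ x)
    (hμ : μ ≤ d) (h : x * p.derivative.eval x = μ * p.eval x) (N : ℕ) :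
    ∃ k : ℕ, |(k : ℝ) - μ * N| ≤ 2 * d * √N ∧
      p.eval x ^ N ≤ 2 * (d * N + 1) * ((p ^ N).coeff k * x ^ k) := by
  rcases Nat.eq_zero_or_pos N with rfl | hN
  · exact ⟨0, by simp, by simp⟩
  by_contra! hcon
  have hq : (p ^ N).natDegree ≤ d * N := natDegree_pow_le.trans (by rw [mul_comm]; gcongr)
  have hP : 0 < p.eval x ^ N := pow_pos (eval_pos_of_coeff_nonneg hp h0 hx) N
  have hv := variance_pow_le hd hp hx hμ h N
  have hN' : (0 : ℝ) < N := by exact_mod_cast hN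
  have hd' : (0 : ℝ) < d := by exact_mod_cast hd1
  set D : ℝ := 4 * d ^ 2 * N with hD
  have hD0 : 0 < D := by positivity
  have key : p.eval x ^ N ≤ ∑ k ∈ Finset.range (d * N + 1),
      (((k : ℝ) - μ * N) ^ 2 * ((p ^ N).coeff k * x ^ k) / D +
        p.eval x ^ N / (2 * (d * N + 1))) := by
    refine (eval_pow (p := p) N ▸ eval_eq_sum_coeff hq x).le.trans ?_
    refine Finset.sum_le_sum fun k _ => ?_
    have ha := mul_nonneg (coeff_pow_nonneg hp N k) (pow_nonneg hx k)
    by_cases hk : |(k : ℝ) - μ * N| ≤ 2 * d * √N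
    · have := hcon k hk
      have h2 : (p ^ N).coeff k * x ^ k ≤ p.eval x ^ N / (2 * (d * N + 1)) := by
        rw [le_div_iff₀ (by positivity)]; linarith
      have h3 : 0 ≤ ((k : ℝ) - μ * N) ^ 2 * ((p ^ N).coeff k * x ^ k) / D := by positivity
      linarith
    · have h2 : D ≤ ((k : ℝ) - μ * N) ^ 2 := by
        rw [← sq_abs, show D = (2 * d * √N) ^ 2 by
          rw [mul_pow, Real.sq_sqrt hN'.le, hD]; ring]
        exact pow_le_pow_left₀ (by positivity) (not_le.1 hk).le 2
      have h3 : (p ^ N).coeff k * x ^ k ≤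
          ((k : ℝ) - μ * N) ^ 2 * ((p ^ N).coeff k * x ^ k) / D := by
        rw [le_div_iff₀ hD0, mul_comm]
        gcongr
      have h4 : 0 ≤ p.eval x ^ N / (2 * (d * N + 1)) := by positivity
      linarith
  rw [Finset.sum_add_distrib, ← Finset.sum_div, Finset.sum_const, Finset.card_range,
    nsmul_eq_mul] at key
  push_cast at key
  have h5 : (d * N + 1) * (p.eval x ^ N / (2 * (d * N + 1))) = p.eval x ^ N / 2 := by
    field_simp
  have h6 : (∑ k ∈ Finset.range (d * N + 1),
      ((k : ℝ) - μ * N) ^ 2 * ((p ^ N).coeff k * x ^ k)) / D ≤ p.eval x ^ N / 4 := by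
    rw [div_le_iff₀ hD0]
    refine hv.trans (le_of_eq ?_)
    rw [hD]; ring
  rw [h5] at key
  linarith

end Coefficients

/-! ### Exponential growth rates and comparison of logarithmic derivatives -/

section Rate

variable {p : ℝ[X]} {d : ℕ}

/-- The large coefficient found by concentration sits at an index only near the target. Setting
aside `s = O(√N)` factors corrects the index exactly, at a cost of `O(√N)` in the logarithm. -/
theorem log_coeff_pow_lower_bound (hd : p.natDegree ≤ d) (hp : ∀ i, 0 ≤ p.coeff i)
    (h1 : ∀ i ≤ d, 1 ≤ p.coeff i) {x μ : ℝ} (hx : 0 < x) (hμ0 : 0 < μ) (hμ : μ < d)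
    (h : x * p.derivative.eval x = μ * p.eval x) {ε : ℝ} (hε : 0 < ε) :
    ∀ᶠ N : ℕ in atTop, N * (Real.log (p.eval x) - μ * Real.log x - ε) ≤
      Real.log ((p ^ N).coeff ⌊μ * N⌋₊) := by
  have hd' : (0 : ℝ) < d := hμ0.trans hμ
  have hd1 : 1 ≤ d := by exact_mod_cast hd'
  have hp0 : 0 < p.coeff 0 := zero_lt_one.trans_le (h1 0 (Nat.zero_le d))
  have hP : 0 < p.eval x := eval_pos_of_coeff_nonneg hp hp0 hx.le
  -- The `s` spare factors must supply a shift between `0` and `d * s`. Its expected value is `μ *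
  -- s`, so the margin on either side is at least `m * s`, which has to absorb the error `2 * d *
  -- √N` and the rounding.
  set m : ℝ := min μ (d - μ) with hm
  have hm0 : 0 < m := lt_min hμ0 (by linarith)
  set A : ℝ := (2 * d + 2) / m + 1 with hA
  have hA0 : 0 < A := by positivity
  -- `B * √N` bounds the total loss: the factors set aside, the displacement of the index, and the
  -- logarithm of the number of terms.
  set B : ℝ := A * |Real.log (p.eval x)| + (d * A + 2 * d) * |Real.log x| +
    2 * √(2 * d + 2) with hB
  have hsq : Tendsto (fun N : ℕ => √(N : ℝ)) atTop atTop :=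
    Real.tendsto_sqrt_atTop.comp tendsto_natCast_atTop_atTop
  filter_upwards [eventually_ge_atTop 1, hsq.eventually_ge_atTop A,
    hsq.eventually_ge_atTop (B / ε)] with N hN hNA hNB
  have hN1 : (1 : ℝ) ≤ N := by exact_mod_cast hN
  set q := √(N : ℝ) with hq
  have hqq : q * q = N := Real.mul_self_sqrt (by linarith)
  have hq1 : 1 ≤ q := Real.one_le_sqrt.2 hN1
  set s := ⌈(2 * d * q + 2) / m⌉₊ with hs
  have hs1 : 2 * d * q + 2 ≤ m * s := by
    rw [← div_le_iff₀' hm0]; exact Nat.le_ceil _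
  have hs2 : (s : ℝ) ≤ A * q := by
    have : (s : ℝ) < (2 * d * q + 2) / m + 1 := Nat.ceil_lt_add_one (by positivity)
    have h2 : (2 * d * q + 2) / m ≤ (2 * d + 2) / m * q := by
      rw [div_mul_eq_mul_div]; gcongr; linarith
    rw [hA, add_mul]; linarith
  have hsN : s ≤ N := by
    have : (s : ℝ) ≤ N := hs2.trans (by rw [← hqq]; gcongr)
    exact_mod_cast this
  obtain ⟨M, hM⟩ : ∃ M, N = M + s := ⟨N - s, by omega⟩
  have hMs : (N : ℝ) = M + s := by exact_mod_cast hM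
  obtain ⟨k1, hk1, hk2⟩ := exists_large_term hd hp hp0 hd1 hx.le hμ.le h M
  have hMq : √(M : ℝ) ≤ q := Real.sqrt_le_sqrt (by linarith [s.cast_nonneg (α := ℝ)])
  have hk1' : |(k1 : ℝ) - μ * M| ≤ 2 * d * q := hk1.trans (by gcongr)
  rw [abs_le] at hk1'
  have hms : m * s ≤ μ * s := by gcongr; exact min_le_left _ _
  have hms' : m * s ≤ (d - μ) * s := by gcongr; exact min_le_right _ _
  set k := ⌊μ * (N : ℝ)⌋₊ with hk
  have hk_le : (k : ℝ) ≤ μ * (M + s) := by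
    have := Nat.floor_le (a := μ * (N : ℝ)) (by positivity)
    rwa [← hk, hMs] at this
  have hk_ge : μ * (M + s) - 1 ≤ (k : ℝ) := by
    have := (Nat.sub_one_lt_floor (μ * (N : ℝ))).le
    rwa [← hk, hMs] at this
  have hk1k : k1 ≤ k := by
    have : (k1 : ℝ) ≤ k := by linarith
    exact_mod_cast this
  obtain ⟨r, hr⟩ : ∃ r, k = k1 + r := ⟨k - k1, by omega⟩
  have hrs : r ≤ d * s := by
    have : (r : ℝ) ≤ d * s := by
      have : (k : ℝ) = k1 + r := by exact_mod_cast hr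
      linarith
    exact_mod_cast this
  have hcoef : (p ^ M).coeff k1 ≤ (p ^ N).coeff k := by
    rw [hM, pow_add, hr]
    refine le_trans ?_ (coeff_mul_coeff_le (coeff_pow_nonneg hp M) (coeff_pow_nonneg hp s) k1 r)
    exact le_mul_of_one_le_right (coeff_pow_nonneg hp M k1) (one_le_coeff_pow hp h1 s r hrs)
  have hc0 : 0 < (p ^ M).coeff k1 := by
    rcases (coeff_pow_nonneg hp M k1).lt_or_eq with h | h
    · exact h
    · rw [← h] at hk2
      simp at hk2
      exact absurd hk2 (not_le.2 (pow_pos hP M))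
  have hlog1 : M * Real.log (p.eval x) ≤
      Real.log (2 * (d * M + 1)) + (Real.log ((p ^ M).coeff k1) + k1 * Real.log x) := by
    have := Real.log_le_log (pow_pos hP M) hk2
    rwa [Real.log_pow, Real.log_mul (by positivity) (mul_pos hc0 (pow_pos hx _)).ne',
      Real.log_mul hc0.ne' (pow_pos hx _).ne', Real.log_pow] at this
  have hlog2 := Real.log_le_log hc0 hcoef
  have hlog3 : Real.log (2 * (d * M + 1)) ≤ 2 * √(2 * d + 2) * q := by
    have e1 : Real.log (2 * (d * M + 1)) = 2 * Real.log √(2 * (d * M + 1)) := by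
      rw [Real.log_sqrt (by positivity)]; ring
    have e2 : Real.log √(2 * (d * M + 1)) ≤ √(2 * (d * M + 1)) :=
      Real.log_le_self (Real.sqrt_nonneg _)
    have e3 : √(2 * (d * M + 1)) ≤ √(2 * d + 2) * q := by
      rw [hq, ← Real.sqrt_mul (by positivity)]
      apply Real.sqrt_le_sqrt
      rw [hMs] at hN1 ⊢
      linarith [mul_nonneg hd'.le (s.cast_nonneg (α := ℝ))]
    linarith
  have hk1x : k1 * Real.log x ≤ μ * (M + s) * Real.log x + (d * A + 2 * d) * q * |Real.log x| := by
    have hb : |(k1 : ℝ) - μ * (M + s)| ≤ (d * A + 2 * d) * q := by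
      have : μ * s ≤ d * (A * q) := by gcongr
      have h0 : 0 ≤ μ * s := by positivity
      rw [abs_le]; constructor <;> linarith
    have : (k1 - μ * (M + s)) * Real.log x ≤ (d * A + 2 * d) * q * |Real.log x| := by
      refine (le_abs_self _).trans ?_
      rw [abs_mul]; gcongr
    linarith
  have hsp : s * Real.log (p.eval x) ≤ A * q * |Real.log (p.eval x)| := by
    refine (le_abs_self _).trans ?_
    rw [abs_mul, Nat.abs_cast]; gcongr
  have hBq : B * q ≤ ε * (M + s) := by
    have : B ≤ ε * q := by rwa [div_le_iff₀' hε] at hNB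
    rw [← hMs, ← hqq, ← mul_assoc]
    gcongr
  rw [hMs]
  rw [hB] at hBq
  linarith

/-- The exponential growth rate of `coeff (p ^ N) ⌊μ N⌋` is `inf_x (log p(x) - μ log x)`. -/
theorem exists_growth_rate (hd : p.natDegree ≤ d) (hp : ∀ i, 0 ≤ p.coeff i)
    (h1 : ∀ i ≤ d, 1 ≤ p.coeff i) {μ : ℝ} (hμ0 : 0 ≤ μ) (hμ : μ ≤ d) :
    ∃ h : ℝ, (∀ ε > 0, ∃ x > 0, Real.log (p.eval x) - μ * Real.log x ≤ h + ε) ∧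
      ∀ ε > 0, ∀ᶠ N : ℕ in atTop, N * (h - ε) ≤ Real.log ((p ^ N).coeff ⌊μ * N⌋₊) := by
  have hp0 : 0 < p.coeff 0 := zero_lt_one.trans_le (h1 0 (Nat.zero_le d))
  have hpd : 0 < p.coeff d := zero_lt_one.trans_le (h1 d le_rfl)
  -- At the endpoints no tilt has mean `μ`. The rate is approached as `x → 0` or `x → ∞`, and the
  -- coefficient is exactly the `N`-th power of an extreme coefficient of `p`.
  rcases hμ0.eq_or_lt with rfl | hμ0
  · refine ⟨Real.log (p.coeff 0), fun ε hε => ?_, fun ε hε => ?_⟩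
    · have hc : ContinuousAt (fun x => Real.log (p.eval x)) 0 :=
        p.continuous.continuousAt.log (eval_pos_of_coeff_nonneg hp hp0 le_rfl).ne'
      have he := hc.tendsto.eventually_lt_const 
        (lt_add_of_pos_right _ hε)
      rw [← coeff_zero_eq_eval_zero] at he
      obtain ⟨x, hx, hx'⟩ := ((he.filter_mono nhdsWithin_le_nhds).and
        (self_mem_nhdsWithin : Set.Ioi (0 : ℝ) ∈ 𝓝[>] 0)).exists
      exact ⟨x, hx', by simpa using hx.le⟩
    · refine Eventually.of_forall fun N => ?_
      rw [zero_mul, Nat.floor_zero, coeff_zero_eq_eval_zero (p ^ N), eval_pow,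
        ← coeff_zero_eq_eval_zero, Real.log_pow]
      gcongr; linarith
  rcases hμ.eq_or_lt with rfl | hμ
  · have hnat : p.natDegree = d := natDegree_eq_of_le_of_coeff_ne_zero hd hpd.ne'
    refine ⟨Real.log (p.coeff d), fun ε hε => ?_, fun ε hε => ?_⟩
    · have ht : Tendsto (fun x => p.eval x / (X ^ d : ℝ[X]).eval x) atTop (𝓝 (p.coeff d)) := by
        have := Polynomial.div_tendsto_atTop_leadingCoeff_div_of_degree_eq p (X ^ d) (by
          rw [degree_X_pow, ← hnat]; exact degree_eq_natDegree (by rintro rfl; simp at hpd))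
        simpa [leadingCoeff, hnat] using this
      have ht2 := (ht.log hpd.ne').eventually_lt_const 
        (lt_add_of_pos_right (Real.log (p.coeff d)) hε)
      obtain ⟨x, hx, hx'⟩ := (ht2.and (eventually_gt_atTop 0)).exists
      refine ⟨x, hx', ?_⟩
      rw [eval_pow, eval_X, Real.log_div (eval_pos_of_coeff_nonneg hp hp0 hx'.le).ne'
        (by positivity), Real.log_pow] at hx
      exact hx.le
    · refine Eventually.of_forall fun N => ?_
      rw [show ((d : ℝ) * N) = ((N * d : ℕ) : ℝ) by push_cast; ring, Nat.floor_natCast,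
        coeff_pow_of_natDegree_le hd, Real.log_pow]
      gcongr; linarith
  · obtain ⟨x, hx, hxe⟩ := exists_mean_eq hd hp0 hpd hμ0 hμ
    exact ⟨Real.log (p.eval x) - μ * Real.log x, fun ε hε => ⟨x, hx, by linarith⟩,
      fun ε hε => log_coeff_pow_lower_bound hd hp h1 hx hμ0 hμ hxe hε⟩

/-- Integrating a comparison of logarithmic derivatives. -/
theorem log_eval_le_of_log_derivative_le {p q : ℝ[X]} (hp : ∀ i, 0 ≤ p.coeff i)
    (hp0 : p.coeff 0 = 1) (hq : ∀ i, 0 ≤ q.coeff i) (hq0 : q.coeff 0 = 1) {c : ℝ}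
    (h : ∀ x > 0, x * q.derivative.eval x * p.eval x ≤ c * (x * p.derivative.eval x) * q.eval x)
    {x : ℝ} (hx : 0 < x) : Real.log (q.eval x) ≤ c * Real.log (p.eval x) := by
  have hP : ∀ y, 0 ≤ y → 0 < p.eval y := fun y hy =>
    eval_pos_of_coeff_nonneg hp (by rw [hp0]; norm_num) hy
  have hQ : ∀ y, 0 ≤ y → 0 < q.eval y := fun y hy =>
    eval_pos_of_coeff_nonneg hq (by rw [hq0]; norm_num) hy
  have hder : ∀ y, 0 ≤ y → HasDerivAt (fun y => c * Real.log (p.eval y) - Real.log (q.eval y))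
      (c * (p.derivative.eval y / p.eval y) - q.derivative.eval y / q.eval y) y := fun y hy =>
    (((p.hasDerivAt y).log (hP y hy).ne').const_mul c).sub ((q.hasDerivAt y).log (hQ y hy).ne')
  have hmono : MonotoneOn (fun y => c * Real.log (p.eval y) - Real.log (q.eval y))
      (Set.Ici 0) := by
    refine monotoneOn_of_deriv_nonneg (convex_Ici 0)
      (fun y hy => (hder y hy).continuousAt.continuousWithinAt)
      (fun y hy => (hder y (interior_subset hy)).differentiableAt.differentiableWithinAt)
      fun y hy => ?_
    rw [interior_Ici] at hy
    have hy' : 0 < y := hy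
    rw [(hder y hy'.le).deriv, sub_nonneg, ← mul_div_assoc, div_le_div_iff₀ (hQ y hy'.le)
      (hP y hy'.le)]
    refine le_of_mul_le_mul_left ?_ hy'
    linarith [h y hy']
  have := hmono (Set.mem_Ici.2 le_rfl) (Set.mem_Ici.2 hx.le) hx.le
  simp only [← coeff_zero_eq_eval_zero, hp0, hq0, Real.log_one] at this
  linarith

end Rate

/-! ### Entropies as extended real numbers -/

section ExtendedReals

theorem logRate_of_pos {a : ℕ} (ha : 0 < a) (n : ℕ) :
    logRate a n = ((Real.log a / n : ℝ) : EReal) := by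
  have : ENNReal.log (a : ENNReal) = (Real.log a : EReal) := by
    rw [← ENNReal.ofReal_natCast, ENNReal.log_ofReal_of_pos (by exact_mod_cast ha)]
  rw [logRate, this, EReal.coe_div]
  norm_cast

theorem logRate_le {a n : ℕ} (hn : 0 < n) {c : ℝ} (h : 0 < a → Real.log a ≤ c * n) :
    logRate a n ≤ (c : EReal) := by
  rcases Nat.eq_zero_or_pos a with rfl | ha
  · have : logRate 0 n = ⊥ := by
      rw [logRate, Nat.cast_zero, ENNReal.log_zero]
      exact EReal.bot_div_of_pos_ne_top (by exact_mod_cast hn) (EReal.natCast_ne_top n)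
    rw [this]; exact bot_le
  · rw [logRate_of_pos ha, EReal.coe_le_coe_iff, div_le_iff₀ (by exact_mod_cast hn)]
    exact h ha

variable {p : ℝ[X]} {d : ℕ}

/-- For a target `z > h / (2d)`, one nearly optimal `x` serves the whole sequence: the bound at `x`
depends on `j` only through `k j / n j`, which tends to `ρ`. It applies to arbitrary regular graphs
and also gives the `limsup` half for `H_{d,n}`. -/
theorem iSup_limsup_logRate_le {ρ h : ℝ}
    (hh : ∀ ε > 0, ∃ x > 0, Real.log (p.eval x) - 2 * d * ρ * Real.log x ≤ h + ε) (hd : 1 ≤ d)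
    {c : ℕ → ℕ → ℕ} {n : ℕ → ℕ} (hn : Tendsto n atTop atTop)
    (hc : ∀ j k, 0 < c j k → ∀ x > 0,
      Real.log (c j k) + k * Real.log x ≤ n j / (2 * d) * Real.log (p.eval x)) :
    ⨆ (k : ℕ → ℕ) (_ : Tendsto (fun j => (k j : ℝ) / (n j : ℝ)) atTop (𝓝 ρ)),
      limsup (fun j => logRate (c j (k j)) (n j)) atTop ≤ ((h / (2 * d) : ℝ) : EReal) := by
  refine iSup₂_le fun k hk => ?_
  have hd' : (0 : ℝ) < 2 * d := by positivity
  refine EReal.le_of_forall_lt_iff_le.1 fun z hz => ?_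
  have hz' : h / (2 * d) < z := by exact_mod_cast hz
  rw [div_lt_iff₀ hd'] at hz'
  obtain ⟨x, hx, hxe⟩ := hh ((z * (2 * d) - h) / 2) (by linarith)
  have ht : Tendsto (fun j => Real.log (p.eval x) / (2 * d) - (k j : ℝ) / n j * Real.log x) atTop
      (𝓝 (Real.log (p.eval x) / (2 * d) - ρ * Real.log x)) :=
    tendsto_const_nhds.sub (hk.mul_const _)
  have hlt : Real.log (p.eval x) / (2 * d) - ρ * Real.log x < z := by
    rw [← sub_pos] at hz' ⊢
    have : z - (Real.log (p.eval x) / (2 * d) - ρ * Real.log x) =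
        (z * (2 * d) - (Real.log (p.eval x) - 2 * d * ρ * Real.log x)) / (2 * d) := by
      field_simp
    rw [this]
    exact div_pos (by linarith) hd'
  refine limsup_le_of_le (by isBoundedDefault) ?_
  filter_upwards [ht.eventually_lt_const hlt, hn.eventually_gt_atTop 0] with j hj hnj
  refine logRate_le hnj fun hpos => ?_
  have hnj' : (0 : ℝ) < n j := by exact_mod_cast hnj
  have h1 := hc j (k j) hpos x hx
  have h2 := mul_le_mul_of_nonneg_right hj.le hnj'.le
  have : (Real.log (p.eval x) / (2 * d) - (k j : ℝ) / n j * Real.log x) * n j =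
      n j / (2 * d) * Real.log (p.eval x) - k j * Real.log x := by
    field_simp
  linarith

theorem tendsto_logRate_unionKdd {ρ h : ℝ} (hρ : 0 ≤ ρ)
    (hh : ∀ ε > 0, ∃ x > 0, Real.log (p.eval x) - 2 * d * ρ * Real.log x ≤ h + ε)
    (hl : ∀ ε > 0, ∀ᶠ N : ℕ in atTop,
      N * (h - ε) ≤ Real.log ((p ^ N).coeff ⌊2 * d * ρ * N⌋₊))
    (hp : ∀ i, 0 ≤ p.coeff i) (h1 : ∀ i ≤ d, 1 ≤ p.coeff i) (hρ1 : ρ ≤ 1 / 2)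
    (hd : 1 ≤ d) {c : ℕ → ℕ → ℕ}
    (hc : ∀ n k, 2 * d ∣ n → 0 < c n k → ∀ x > 0,
      Real.log (c n k) + k * Real.log x ≤ n / (2 * d) * Real.log (p.eval x))
    (hcl : ∀ N k, (p ^ N).coeff k ≤ c (2 * d * N) k) :
    Tendsto (fun n : ℕ => logRate (c n ⌊ρ * (n : ℝ)⌋₊) n) (atTopDvd d)
      (𝓝 ((h / (2 * d) : ℝ) : EReal)) := by
  have hd' : (0 : ℝ) < 2 * d := by positivity
  -- Along multiples of `2d` the limit becomes one over the number `N` of copies.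
  have hmap : atTopDvd d ≤ map (fun N : ℕ => 2 * d * N) atTop := by
    intro s hs
    obtain ⟨N0, hN0⟩ := mem_atTop_sets.1 (mem_map.1 hs)
    rw [atTopDvd, mem_inf_principal]
    filter_upwards [eventually_ge_atTop (2 * d * N0)] with n hn hdvd
    obtain ⟨N, rfl⟩ := hdvd
    exact hN0 N (Nat.le_of_mul_le_mul_left hn (by omega))
  refine Tendsto.mono_left ?_ hmap
  rw [tendsto_map'_iff]
  have hk : ∀ N : ℕ, ρ * ((2 * d * N : ℕ) : ℝ) = 2 * d * ρ * N := fun N => by push_cast; ring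
  refine tendsto_of_le_liminf_of_limsup_le ?_ ?_
  · refine EReal.ge_of_forall_gt_iff_ge.1 fun z hz => ?_
    have hz' : z < h / (2 * d) := by exact_mod_cast hz
    rw [lt_div_iff₀ hd'] at hz'
    refine le_liminf_of_le (by isBoundedDefault) ?_
    filter_upwards [hl (h - z * (2 * d)) (by linarith), eventually_gt_atTop 0] with N hN hN0
    have hN0' : (0 : ℝ) < N := by exact_mod_cast hN0
    -- `ρ ≤ 1/2` keeps the index in the range where the coefficients of `p ^ N` are at least `1`, so
    -- that no logarithm of `0` occurs.
    have hkd : ⌊2 * d * ρ * N⌋₊ ≤ d * N := by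
      refine Nat.floor_le_of_le ?_
      push_cast
      have := mul_le_mul_of_nonneg_left hρ1 (by positivity : (0 : ℝ) ≤ 2 * d * N)
      linarith
    have hpos := one_le_coeff_pow hp h1 N _ hkd
    have hle := hcl N ⌊2 * d * ρ * N⌋₊
    have hcpos : 0 < c (2 * d * N) ⌊2 * d * ρ * N⌋₊ := by
      have := hpos.trans hle
      exact_mod_cast zero_lt_one.trans_le this
    have hlog := Real.log_le_log (zero_lt_one.trans_le hpos) hle
    simp only [Function.comp_apply, hk]
    rw [logRate_of_pos hcpos, EReal.coe_le_coe_iff, le_div_iff₀ (by positivity)]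
    push_cast
    linarith
  · have hbd := iSup_limsup_logRate_le (n := fun N => 2 * d * N) (ρ := ρ) hh hd
      (c := fun N => c (2 * d * N))
      (tendsto_id.const_mul_atTop' (by positivity : 0 < 2 * d))
      (fun N k => hc (2 * d * N) k (dvd_mul_right _ _))
    refine le_trans ?_ hbd
    refine le_iSup₂_of_le (fun N : ℕ => ⌊ρ * ((2 * d * N : ℕ) : ℝ)⌋₊) ?_ le_rfl
    exact (tendsto_nat_floor_mul_div_atTop hρ).comp ((tendsto_natCast_atTop_atTop (R := ℝ)).comp
      (tendsto_id.const_mul_atTop' (by positivity : 0 < 2 * d)))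

end ExtendedReals

/-! ### Independent sets: the occupancy method with lower sets -/

section IndependentSets

/-- Chebyshev's sum inequality: when `a k / e k` decreases, the weights `a` have the smaller mean.
Symmetrizing the double sum in `k` and `l` makes every term nonpositive. -/
theorem sub_mul_sum_nonpos {n : ℕ} {a e : ℕ → ℝ} {x : ℝ} (hx : 0 ≤ x)
    (h : ∀ l k, l ≤ k → a k * e l ≤ a l * e k) :
    (∑ k ∈ Finset.Icc 1 n, k * (a k * x ^ k)) * (∑ k ∈ Finset.Icc 1 n, e k * x ^ k) ≤
      (∑ k ∈ Finset.Icc 1 n, k * (e k * x ^ k)) * (∑ k ∈ Finset.Icc 1 n, a k * x ^ k) := by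
  have hterm : ∀ k l : ℕ, ((k : ℝ) - l) * (a k * e l - a l * e k) * x ^ (k + l) ≤ 0 := fun k l => by
    refine mul_nonpos_of_nonpos_of_nonneg ?_ (pow_nonneg hx _)
    rcases le_total l k with hlk | hlk
    · exact mul_nonpos_of_nonneg_of_nonpos (sub_nonneg.2 (by exact_mod_cast hlk))
        (by linarith [h l k hlk])
    · exact mul_nonpos_of_nonpos_of_nonneg (sub_nonpos.2 (by exact_mod_cast hlk))
        (by linarith [h k l hlk])
  have hsum := Finset.sum_nonpos fun k (_ : k ∈ Finset.Icc 1 n) =>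
    Finset.sum_nonpos fun l (_ : l ∈ Finset.Icc 1 n) => hterm k l
  set S := ∑ k ∈ Finset.Icc 1 n, ∑ l ∈ Finset.Icc 1 n,
    (k * (a k * x ^ k) * (e l * x ^ l) - k * (e k * x ^ k) * (a l * x ^ l)) with hS
  have h1 : S = (∑ k ∈ Finset.Icc 1 n, k * (a k * x ^ k)) * (∑ k ∈ Finset.Icc 1 n, e k * x ^ k) -
      (∑ k ∈ Finset.Icc 1 n, k * (e k * x ^ k)) * (∑ k ∈ Finset.Icc 1 n, a k * x ^ k) := by
    simp only [hS, Finset.sum_sub_distrib, Finset.sum_mul_sum]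
  have h2 : S + S = ∑ k ∈ Finset.Icc 1 n, ∑ l ∈ Finset.Icc 1 n,
      ((k : ℝ) - l) * (a k * e l - a l * e k) * x ^ (k + l) := by
    conv_lhs => rw [hS]; arg 2; rw [Finset.sum_comm]
    simp only [← Finset.sum_add_distrib]
    refine Finset.sum_congr rfl fun k _ => Finset.sum_congr rfl fun l _ => ?_
    rw [pow_add]; ring
  linarith

/-- Double counting of pairs `B ⊆ A` in consecutive layers: all `k + 1` subsets `A.erase a` stay in
the family, and `B` extends in at most `F.card - k` ways. -/
theorem succ_mul_card_le_of_lowerSet {α : Type*} [DecidableEq α] {F : Finset α}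
    {𝒜 : Finset (Finset α)} (hF : 𝒜 ⊆ F.powerset)
    (hdown : ∀ A ∈ 𝒜, ∀ B ⊆ A, B ∈ 𝒜) (k : ℕ) :
    (𝒜.filter (·.card = k + 1)).card * (k + 1) ≤ (𝒜.filter (·.card = k)).card * (F.card - k) := by
  refine Finset.card_mul_le_card_mul (fun A B => B ⊆ A) (fun A hA => ?_) (fun B hB => ?_)
  · rw [Finset.mem_filter] at hA
    have hinj : Set.InjOn (fun a => A.erase a) A := fun a ha b _ hab => by
      by_contra hne
      have : a ∈ A.erase b := Finset.mem_erase.2 ⟨hne, ha⟩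
      simp only at hab
      rw [← hab] at this
      exact Finset.notMem_erase a A this
    rw [← hA.2, ← Finset.card_image_of_injOn hinj]
    refine Finset.card_le_card fun B hB => ?_
    obtain ⟨a, ha, rfl⟩ := Finset.mem_image.1 hB
    rw [Finset.mem_bipartiteAbove, Finset.mem_filter]
    exact ⟨⟨hdown A hA.1 _ (Finset.erase_subset a A), by
      rw [Finset.card_erase_of_mem ha, hA.2]; rfl⟩, Finset.erase_subset a A⟩
  · rw [Finset.mem_filter] at hB
    have hBF := Finset.mem_powerset.1 (hF hB.1)
    rw [← hB.2, ← Finset.card_sdiff_of_subset hBF]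
    refine (Finset.card_le_card fun A hA => ?_).trans
      (Finset.card_image_le (s := F \ B) (f := fun a => insert a B))
    rw [Finset.mem_bipartiteBelow, Finset.mem_filter] at hA
    obtain ⟨⟨hA, hAc⟩, hBA⟩ := hA
    obtain ⟨a, ha⟩ : ∃ a, A \ B = {a} := by
      rw [← Finset.card_eq_one, Finset.card_sdiff_of_subset hBA]; omega
    have haA : a ∈ A \ B := by rw [ha]; simp
    rw [Finset.mem_sdiff] at haA
    refine Finset.mem_image.2 ⟨a, Finset.mem_sdiff.2 ⟨Finset.mem_powerset.1 (hF hA) haA.1, haA.2⟩, ?_⟩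
    rw [Finset.insert_eq, ← ha, Finset.sdiff_union_of_subset hBA]

theorem sum_card_filter_mul {α : Type*} (𝒜 : Finset (Finset α)) {n : ℕ}
    (h : ∀ A ∈ 𝒜, A.card ≤ n) (f : ℕ → ℝ) :
    ∑ A ∈ 𝒜, f A.card = ∑ k ∈ Finset.range (n + 1), (𝒜.filter (·.card = k)).card * f k := by
  rw [← Finset.sum_fiberwise_of_maps_to (t := Finset.range (n + 1)) (g := Finset.card)
    (fun A hA => Finset.mem_range.2 (Nat.lt_succ_iff.2 (h A hA)))]
  refine Finset.sum_congr rfl fun k _ => ?_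
  rw [Finset.sum_congr rfl (g := fun _ => f k) fun A hA => by rw [(Finset.mem_filter.1 hA).2],
    Finset.sum_const, nsmul_eq_mul]

theorem sum_range_succ_eq_add_Icc (f : ℕ → ℝ) (n : ℕ) :
    ∑ k ∈ Finset.range (n + 1), f k = f 0 + ∑ k ∈ Finset.Icc 1 n, f k := by
  rw [Finset.range_eq_Ico, Finset.sum_eq_sum_Ico_succ_bot (by omega)]
  rfl

/-- Among the lower sets of finite sets on `d` points, the full power set maximizes the mean size of
a nonempty member under the weight `x ^ card`. -/
theorem sum_card_mul_pow_le_of_lowerSet {α : Type*} [DecidableEq α] {F : Finset α}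
    {𝒜 : Finset (Finset α)} (hF : 𝒜 ⊆ F.powerset) (hdown : ∀ A ∈ 𝒜, ∀ B ⊆ A, B ∈ 𝒜)
    (hempty : ∅ ∈ 𝒜) {x : ℝ} (hx : 0 ≤ x) :
    (∑ A ∈ 𝒜, A.card * x ^ A.card) * ((1 + x) ^ F.card - 1) ≤
      F.card * x * (1 + x) ^ (F.card - 1) * (∑ A ∈ 𝒜, x ^ A.card - 1) := by
  set d := F.card with hd
  set a : ℕ → ℝ := fun k => ((𝒜.filter (·.card = k)).card : ℝ) with ha
  set e : ℕ → ℝ := fun k => (d.choose k : ℝ) with he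
  have hcard : ∀ A ∈ 𝒜, A.card ≤ d := fun A hA =>
    Finset.card_le_card (Finset.mem_powerset.1 (hF hA))
  have hcard' : ∀ A ∈ F.powerset, A.card ≤ d := fun A hA =>
    Finset.card_le_card (Finset.mem_powerset.1 hA)
  -- The density of a lower set in the layers of the cube is nonincreasing; above layer `d` it has
  -- no members.
  have hratio : ∀ l k, l ≤ k → a k * e l ≤ a l * e k := by
    intro l k hlk
    induction k, hlk using Nat.le_induction with
    | base => rfl
    | succ k _ ih =>
      rcases lt_or_ge k d with hk | hk
      · have h1 : a (k + 1) * (k + 1) ≤ a k * (d - k) := by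
          have := succ_mul_card_le_of_lowerSet hF hdown k
          rw [← hd] at this
          have h2 : ((d - k : ℕ) : ℝ) = d - k := Nat.cast_sub hk.le
          simp only [ha, ← h2]
          exact_mod_cast this
        have h3 : e (k + 1) * (k + 1) = e k * (d - k) := by
          simp only [he, ← Nat.cast_sub hk.le]
          exact_mod_cast Nat.choose_succ_right_eq d k
        have hkpos : (0 : ℝ) < k + 1 := by positivity
        have hdk : (0 : ℝ) ≤ d - k := sub_nonneg.2 (by exact_mod_cast hk.le)
        refine le_of_mul_le_mul_right ?_ hkpos
        calc a (k + 1) * e l * (k + 1) = a (k + 1) * (k + 1) * e l := by ring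
          _ ≤ a k * (d - k) * e l := by gcongr
          _ = a k * e l * (d - k) := by ring
          _ ≤ a l * e k * (d - k) := by gcongr
          _ = a l * e (k + 1) * (k + 1) := by rw [mul_assoc, ← h3, mul_assoc]
      · have : a (k + 1) = 0 := by
          simp only [ha, Nat.cast_eq_zero, Finset.card_eq_zero, Finset.filter_eq_empty_iff]
          intro A hA hAk
          have := hcard A hA
          omega
        rw [this, zero_mul]
        positivity
  have key := sub_mul_sum_nonpos (n := d) hx hratio
  have ha0 : a 0 = 1 := by
    have : 𝒜.filter (·.card = 0) = {∅} := by
      ext A; simp only [Finset.mem_filter, Finset.card_eq_zero, Finset.mem_singleton]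
      exact ⟨fun h => h.2, fun h => ⟨h ▸ hempty, h⟩⟩
    simp only [ha]; rw [this]; simp
  have s1 : ∑ A ∈ 𝒜, (A.card : ℝ) * x ^ A.card = ∑ k ∈ Finset.Icc 1 d, k * (a k * x ^ k) := by
    rw [sum_card_filter_mul 𝒜 hcard (fun k => k * x ^ k), sum_range_succ_eq_add_Icc]
    simp only [Nat.cast_zero, zero_mul, mul_zero, zero_add]
    exact Finset.sum_congr rfl fun k _ => by simp only [ha]; ring
  have s2 : ∑ A ∈ 𝒜, x ^ A.card - 1 = ∑ k ∈ Finset.Icc 1 d, a k * x ^ k := by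
    rw [sum_card_filter_mul 𝒜 hcard (fun k => x ^ k), sum_range_succ_eq_add_Icc]
    change a 0 * x ^ 0 + _ - 1 = _
    rw [ha0]; ring
  have hbin : (1 + X : ℝ[X]) ^ d = ∑ k ∈ Finset.range (d + 1), C (e k) * X ^ k := by
    rw [add_comm, add_pow]
    refine Finset.sum_congr rfl fun k _ => ?_
    simp only [he, one_pow, mul_one, map_natCast]
    ring
  have s3 : (1 + x) ^ d - 1 = ∑ k ∈ Finset.Icc 1 d, e k * x ^ k := by
    have := congrArg (eval x) hbin
    simp only [eval_pow, eval_add, eval_one, eval_X, eval_finsetSum, eval_mul, eval_C] at this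
    rw [this, sum_range_succ_eq_add_Icc]
    simp [he]
  have s4 : d * x * (1 + x) ^ (d - 1) = ∑ k ∈ Finset.Icc 1 d, k * (e k * x ^ k) := by
    have hnd : ((1 + X : ℝ[X]) ^ d).natDegree ≤ d := by compute_degree
    have := mul_derivative_eval hnd x
    rw [sum_range_succ_eq_add_Icc] at this
    simp only [derivative_pow, derivative_add, derivative_one, derivative_X, eval_mul, eval_pow,
      eval_add, eval_one, eval_X, eval_C, zero_add, mul_one, Nat.cast_zero, zero_mul,
      coeff_one_add_X_pow] at this
    rw [← this]; ring
  rw [s1, s2, s3, s4]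
  exact key

variable {V : Type*} [Fintype V]

open Classical in
/-- The finite family of independent sets. -/
noncomputable def indepSets (G : SimpleGraph V) : Finset (Finset V) :=
  Finset.univ.filter fun s => G.IsIndepSet (s : Set V)

theorem mem_indepSets {G : SimpleGraph V} {s : Finset V} :
    s ∈ indepSets G ↔ ∀ v ∈ s, ∀ w ∈ s, ¬ G.Adj v w := by
  simp only [indepSets, Finset.mem_filter, Finset.mem_univ, true_and]
  exact ⟨fun h v hv w hw hadj => h hv hw hadj.ne hadj, fun h v hv w hw _ => h v hv w hw⟩

/-- The independence polynomial. -/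
noncomputable def indepPoly (G : SimpleGraph V) : ℝ[X] :=
  ∑ s ∈ indepSets G, X ^ s.card

theorem coeff_sum_X_pow_card {α : Type*} (𝒜 : Finset (Finset α)) (k : ℕ) :
    (∑ A ∈ 𝒜, X ^ A.card : ℝ[X]).coeff k = (𝒜.filter (·.card = k)).card := by
  rw [finsetSum_coeff, Finset.card_filter]
  push_cast
  exact Finset.sum_congr rfl fun A _ => by simp [coeff_X_pow, eq_comm]

theorem mul_derivative_eval_sum_X_pow_card {α : Type*} (𝒜 : Finset (Finset α)) (x : ℝ) :
    x * (∑ A ∈ 𝒜, X ^ A.card : ℝ[X]).derivative.eval x = ∑ A ∈ 𝒜, A.card * x ^ A.card := by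
  rw [derivative_sum, eval_finsetSum, Finset.mul_sum]
  refine Finset.sum_congr rfl fun A _ => ?_
  rw [derivative_X_pow, eval_mul, eval_C, eval_pow, eval_X]
  rcases A.card with _ | m
  · simp
  · rw [Nat.add_sub_cancel, pow_succ]; ring

theorem coeff_indepPoly (G : SimpleGraph V) (k : ℕ) :
    (indepPoly G).coeff k = numIndepSets G k := by
  classical
  rw [indepPoly, coeff_sum_X_pow_card, numIndepSets, ← Set.ncard_coe_finset]
  congr 2
  ext s
  simp [SimpleGraph.isNIndepSet_iff, indepSets]

theorem indepPoly_prod {ι : Type*} [Fintype ι] (G : SimpleGraph V) (H : SimpleGraph (ι × V))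
    (hH : ∀ x y, H.Adj x y ↔ x.1 = y.1 ∧ G.Adj x.2 y.2) :
    indepPoly H = indepPoly G ^ Fintype.card ι := by
  classical
  rw [indepPoly, indepPoly, ← Finset.card_univ, ← Finset.prod_const, Finset.prod_univ_sum]
  symm
  refine Finset.sum_bij' (fun f _ => Finset.univ.filter fun x : ι × V => x.2 ∈ f x.1)
    (fun S _ i => Finset.univ.filter fun v => (i, v) ∈ S) ?_ ?_ ?_ ?_ ?_
  · intro f hf
    rw [Fintype.mem_piFinset] at hf
    rw [mem_indepSets]
    rintro ⟨i, v⟩ hv ⟨j, w⟩ hw hadj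
    simp only [Finset.mem_filter, Finset.mem_univ, true_and] at hv hw
    rw [hH] at hadj
    obtain ⟨rfl, hadj⟩ := hadj
    exact mem_indepSets.1 (hf i) v hv w hw hadj
  · intro S hS
    rw [Fintype.mem_piFinset]
    intro i
    rw [mem_indepSets] at hS ⊢
    intro v hv w hw hadj
    simp only [Finset.mem_filter, Finset.mem_univ, true_and] at hv hw
    exact hS _ hv _ hw ((hH _ _).2 ⟨rfl, hadj⟩)
  · intro f _; ext i v; simp
  · intro S _; ext ⟨i, v⟩; simp
  · intro f _
    rw [Finset.prod_pow_eq_pow_sum]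
    congr 1
    rw [Finset.card_filter, Fintype.sum_prod_type]
    refine Finset.sum_congr rfl fun i _ => ?_
    simp

/-- An independent set lies within one side. The empty set lies in both, whence the `-1`. -/
theorem indepPoly_completeBipartiteGraph (d : ℕ) :
    indepPoly (completeBipartiteGraph (Fin d) (Fin d)) = 2 * (1 + X) ^ d - 1 := by
  classical
  have hpow : ∑ s : Finset (Fin d), (X : ℝ[X]) ^ s.card = (1 + X) ^ d := by
    have := Fintype.sum_pow_mul_eq_add_pow (Fin d) (X : ℝ[X]) 1
    simpa [add_comm] using this
  have hsplit : indepSets (completeBipartiteGraph (Fin d) (Fin d)) =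
      (Finset.univ.map (Finset.mapEmbedding Function.Embedding.inl).toEmbedding) ∪
      ((Finset.univ.erase ∅).map (Finset.mapEmbedding Function.Embedding.inr).toEmbedding) := by
    ext s
    simp only [mem_indepSets, Finset.mem_union, Finset.mem_map, Finset.mem_univ, true_and,
      Finset.mem_erase, and_true, RelEmbedding.coe_toEmbedding, Finset.mapEmbedding_apply]
    constructor
    · intro h
      by_cases hr : ∃ b, Sum.inr b ∈ s
      · obtain ⟨b, hb⟩ := hr
        refine Or.inr ⟨s.toRight, Finset.ne_empty_of_mem (Finset.mem_toRight.2 hb), ?_⟩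
        ext (a | a)
        · simpa using fun ha => h _ ha _ hb (by simp)
        · simp
      · push Not at hr
        refine Or.inl ⟨s.toLeft, ?_⟩
        ext (a | a)
        · simp
        · simpa using hr a
    · rintro (⟨A, rfl⟩ | ⟨A, -, rfl⟩) v hv w hw <;>
      · obtain ⟨a, -, rfl⟩ := Finset.mem_map.1 hv
        obtain ⟨b, -, rfl⟩ := Finset.mem_map.1 hw
        simp
  rw [indepPoly, hsplit, Finset.sum_union, Finset.sum_map, Finset.sum_map]
  · have := Finset.sum_erase_add (Finset.univ) (fun s : Finset (Fin d) => (X : ℝ[X]) ^ s.card)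
      (Finset.mem_univ ∅)
    rw [hpow] at this
    simp only [RelEmbedding.coe_toEmbedding, Finset.mapEmbedding_apply, Finset.card_map, hpow,
      Finset.card_empty, pow_zero] at this ⊢
    linear_combination this
  · rw [Finset.disjoint_left]
    intro s hs hs'
    obtain ⟨A, -, rfl⟩ := Finset.mem_map.1 hs
    obtain ⟨B, hB, hBA⟩ := Finset.mem_map.1 hs'
    obtain ⟨b, hb⟩ := Finset.nonempty_iff_ne_empty.2 (Finset.mem_erase.1 hB).1
    have : Sum.inr b ∈ B.map (Function.Embedding.inr (α := Fin d)) := by simpa using hb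
    simp only [RelEmbedding.coe_toEmbedding, Finset.mapEmbedding_apply] at hBA
    rw [hBA] at this
    simp at this

open Classical in
/-- The local inequality at a vertex `u`: condition on the independent set away from the closed
neighbourhood of `u`. -/
theorem sum_card_inter_neighbors_le (G : SimpleGraph V) (u : V) {x : ℝ} (hx : 0 < x) :
    let F := Finset.univ.filter (G.Adj u)
    (∑ s ∈ indepSets G, (s ∩ F).card * x ^ s.card) * ((1 + x) ^ F.card - 1) ≤
      F.card * x * (1 + x) ^ (F.card - 1) *
        (∑ s ∈ indepSets G, x ^ s.card -
          (1 + 1 / x) * ∑ s ∈ indepSets G with u ∈ s, x ^ s.card) := by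
  intro F
  -- `J` ranges over the independent sets missing the closed neighbourhood of `u`. Each extends
  -- either by `u` or by a member of the lower set `𝒜 J` of subsets of `F`.
  set 𝒥 := (indepSets G).filter fun s => u ∉ s ∧ Disjoint s F with h𝒥
  set 𝒜 : Finset V → Finset (Finset V) := fun J =>
    F.powerset.filter fun A => J ∪ A ∈ indepSets G with h𝒜
  have huF : u ∉ F := by simp [F]
  have hwith : ∀ f : Finset V → ℝ, ∑ s ∈ indepSets G with u ∈ s, f s = ∑ J ∈ 𝒥, f (insert u J) := by
    intro f
    refine Finset.sum_bij' (fun s _ => s.erase u) (fun J _ => insert u J) ?_ ?_ ?_ ?_ ?_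
    · intro s hs
      rw [Finset.mem_filter, mem_indepSets] at hs
      rw [h𝒥, Finset.mem_filter, mem_indepSets]
      refine ⟨fun v hv w hw => hs.1 v (Finset.mem_of_mem_erase hv) w (Finset.mem_of_mem_erase hw),
        Finset.notMem_erase u s, Finset.disjoint_left.2 fun v hv hvF => ?_⟩
      exact hs.1 u hs.2 v (Finset.mem_of_mem_erase hv) (Finset.mem_filter.1 hvF).2
    · intro J hJ
      rw [h𝒥, Finset.mem_filter, mem_indepSets] at hJ
      rw [Finset.mem_filter, mem_indepSets]
      refine ⟨fun v hv w hw hadj => ?_, Finset.mem_insert_self u J⟩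
      have hF : ∀ z ∈ J, ¬ G.Adj u z := fun z hz hz' =>
        Finset.disjoint_left.1 hJ.2.2 hz (Finset.mem_filter.2 ⟨Finset.mem_univ z, hz'⟩)
      rcases Finset.mem_insert.1 hv with rfl | hv' <;>
        rcases Finset.mem_insert.1 hw with rfl | hw'
      · exact hadj.ne rfl
      · exact hF w hw' hadj
      · exact hF v hv' hadj.symm
      · exact hJ.1 v hv' w hw' hadj
    · intro s hs; exact Finset.insert_erase (Finset.mem_filter.1 hs).2
    · intro J hJ; exact Finset.erase_insert (Finset.mem_filter.1 hJ).2.1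
    · intro s hs; rw [Finset.insert_erase (Finset.mem_filter.1 hs).2]
  have hdown0 : ∀ s ∈ indepSets G, ∀ t ⊆ s, t ∈ indepSets G := fun s hs t hts =>
    mem_indepSets.2 fun v hv w hw => mem_indepSets.1 hs v (hts hv) w (hts hw)
  have hwithout : ∀ f : Finset V → ℝ, ∑ s ∈ indepSets G with u ∉ s, f s =
      ∑ J ∈ 𝒥, ∑ A ∈ 𝒜 J, f (J ∪ A) := by
    intro f
    rw [Finset.sum_sigma']
    refine Finset.sum_bij' (fun s _ => ⟨s \ F, s ∩ F⟩) (fun P _ => P.1 ∪ P.2) ?_ ?_ ?_ ?_ ?_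
    · intro s hs
      rw [Finset.mem_filter] at hs
      rw [Finset.mem_sigma, h𝒥, h𝒜, Finset.mem_filter, Finset.mem_filter, Finset.mem_powerset,
        Finset.sdiff_union_inter]
      exact ⟨⟨hdown0 s hs.1 _ Finset.sdiff_subset, fun h => hs.2 (Finset.sdiff_subset h),
        Finset.sdiff_disjoint⟩, Finset.inter_subset_right, hs.1⟩
    · rintro ⟨J, A⟩ hP
      rw [Finset.mem_sigma, h𝒥, h𝒜, Finset.mem_filter, Finset.mem_filter,
        Finset.mem_powerset] at hP
      rw [Finset.mem_filter, Finset.mem_union]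
      exact ⟨hP.2.2, fun h => h.elim hP.1.2.1 fun h => huF (hP.2.1 h)⟩
    · intro s _; exact Finset.sdiff_union_inter s F
    · rintro ⟨J, A⟩ hP
      rw [Finset.mem_sigma, h𝒥, h𝒜, Finset.mem_filter, Finset.mem_filter,
        Finset.mem_powerset] at hP
      obtain ⟨⟨-, -, hJF⟩, hAF, -⟩ := hP
      simp only at hJF hAF
      have h1 : (J ∪ A) \ F = J := by
        rw [Finset.union_sdiff_distrib, Finset.sdiff_eq_self_of_disjoint hJF,
          Finset.sdiff_eq_empty_iff_subset.2 hAF, Finset.union_empty]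
      have h2 : (J ∪ A) ∩ F = A := by
        rw [Finset.union_inter_distrib_right, Finset.disjoint_iff_inter_eq_empty.1 hJF,
          Finset.inter_eq_left.2 hAF, Finset.empty_union]
      simp only [h1, h2]
    · intro s _; simp only [Finset.sdiff_union_inter]
  have hJcard : ∀ J ∈ 𝒥, (insert u J).card = J.card + 1 := fun J hJ =>
    Finset.card_insert_of_notMem (Finset.mem_filter.1 hJ).2.1
  have hJA : ∀ J ∈ 𝒥, ∀ A ∈ 𝒜 J, Disjoint J F ∧ A ⊆ F := fun J hJ A hA =>
    ⟨(Finset.mem_filter.1 hJ).2.2, Finset.mem_powerset.1 (Finset.mem_filter.1 hA).1⟩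
  have hb : ∑ s ∈ indepSets G, ((s ∩ F).card : ℝ) * x ^ s.card =
      ∑ J ∈ 𝒥, x ^ J.card * ∑ A ∈ 𝒜 J, A.card * x ^ A.card := by
    rw [← Finset.sum_filter_add_sum_filter_not _ (fun s => u ∈ s), hwith, hwithout]
    rw [Finset.sum_eq_zero (s := 𝒥), zero_add]
    · refine Finset.sum_congr rfl fun J hJ => ?_
      rw [Finset.mul_sum]
      refine Finset.sum_congr rfl fun A hA => ?_
      obtain ⟨hJF, hAF⟩ := hJA J hJ A hA
      rw [Finset.card_union_of_disjoint (Finset.disjoint_of_subset_right hAF hJF),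
        Finset.union_inter_distrib_right, Finset.disjoint_iff_inter_eq_empty.1 hJF,
        Finset.inter_eq_left.2 hAF, Finset.empty_union, pow_add]
      ring
    · intro J hJ
      rw [Finset.insert_inter_of_notMem huF,
        Finset.disjoint_iff_inter_eq_empty.1 (Finset.mem_filter.1 hJ).2.2]
      simp
  have ha : ∑ s ∈ indepSets G with u ∈ s, x ^ s.card = x * ∑ J ∈ 𝒥, x ^ J.card := by
    rw [hwith, Finset.mul_sum]
    exact Finset.sum_congr rfl fun J hJ => by rw [hJcard J hJ, pow_succ']
  have hz : ∑ s ∈ indepSets G, x ^ s.card = x * ∑ J ∈ 𝒥, x ^ J.card +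
      ∑ J ∈ 𝒥, x ^ J.card * ∑ A ∈ 𝒜 J, x ^ A.card := by
    rw [← Finset.sum_filter_add_sum_filter_not _ (fun s => u ∈ s), ha, hwithout]
    congr 1
    refine Finset.sum_congr rfl fun J hJ => ?_
    rw [Finset.mul_sum]
    refine Finset.sum_congr rfl fun A hA => ?_
    obtain ⟨hJF, hAF⟩ := hJA J hJ A hA
    rw [Finset.card_union_of_disjoint (Finset.disjoint_of_subset_right hAF hJF), pow_add]
  -- The factor `1 + 1 / x` removes both the sets containing `u` (weight `x` per `J`) and the case
  -- `A = ∅` (weight `1` per `J`), leaving the nonempty `A`.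
  have hz' : ∑ s ∈ indepSets G, x ^ s.card -
      (1 + 1 / x) * ∑ s ∈ indepSets G with u ∈ s, x ^ s.card =
      ∑ J ∈ 𝒥, x ^ J.card * (∑ A ∈ 𝒜 J, x ^ A.card - 1) := by
    rw [hz, ha]
    simp only [mul_sub, mul_one, Finset.sum_sub_distrib]
    field_simp
    ring
  rw [hb, hz', Finset.sum_mul, Finset.mul_sum]
  refine Finset.sum_le_sum fun J hJ => ?_
  have := sum_card_mul_pow_le_of_lowerSet (F := F) (𝒜 := 𝒜 J) (Finset.filter_subset _ _)
    (fun A hA B hBA => by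
      rw [h𝒜, Finset.mem_filter, Finset.mem_powerset] at hA ⊢
      exact ⟨hBA.trans hA.1, hdown0 _ hA.2 _ (Finset.union_subset_union_right hBA)⟩)
    (by rw [h𝒜, Finset.mem_filter, Finset.union_empty]
        exact ⟨Finset.empty_mem_powerset F, (Finset.mem_filter.1 hJ).1⟩) hx.le
  have h2 := mul_le_mul_of_nonneg_left this (pow_pos hx J.card).le
  linarith

open Classical in
-- Summed over `u`, the weight of `u ∈ s` gives `D` and that of the neighbours of `u` in `s` gives
-- `d * D`, by regularity. The local inequality becomes linear in `D`, and collecting its terms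
-- produces `2 * (1 + x) ^ d - 1`.
theorem indepPoly_log_derivative_le (G : SimpleGraph V) {d : ℕ} (hd : 1 ≤ d)
    (hG : ∀ v, (Finset.univ.filter (G.Adj v)).card = d) {x : ℝ} (hx : 0 < x) :
    x * (indepPoly G).derivative.eval x * (2 * (1 + X : ℝ[X]) ^ d - 1).eval x ≤
      Fintype.card V / (2 * d) * (x * (2 * (1 + X : ℝ[X]) ^ d - 1).derivative.eval x) *
        (indepPoly G).eval x := by
  have hd' : (0 : ℝ) < d := by exact_mod_cast hd
  set D := x * (indepPoly G).derivative.eval x with hD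
  have hD1 : D = ∑ s ∈ indepSets G, s.card * x ^ s.card := mul_derivative_eval_sum_X_pow_card _ x
  set Z := (indepPoly G).eval x with hZ
  have hZ1 : Z = ∑ s ∈ indepSets G, x ^ s.card := by
    rw [hZ, indepPoly, eval_finsetSum]; simp
  have hsum := Finset.sum_le_sum fun u (_ : u ∈ Finset.univ) => sum_card_inter_neighbors_le G u hx
  simp only [hG, ← hZ1] at hsum
  rw [← Finset.sum_mul, ← Finset.mul_sum, Finset.sum_sub_distrib, ← Finset.mul_sum,
    Finset.sum_const, Finset.card_univ, nsmul_eq_mul] at hsum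
  have e1 : ∑ u, ∑ s ∈ indepSets G with u ∈ s, x ^ s.card = D := by
    simp only [Finset.sum_filter]
    rw [Finset.sum_comm, hD1]
    exact Finset.sum_congr rfl fun s _ => by simp
  have e2 : ∑ u, ∑ s ∈ indepSets G, ((s ∩ Finset.univ.filter (G.Adj u)).card : ℝ) * x ^ s.card =
      d * D := by
    rw [Finset.sum_comm, hD1, Finset.mul_sum]
    refine Finset.sum_congr rfl fun s _ => ?_
    rw [← Finset.sum_mul, ← mul_assoc]
    congr 1
    have : ∀ u, ((s ∩ Finset.univ.filter (G.Adj u)).card : ℝ) =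
        ∑ v ∈ s, if G.Adj v u then 1 else 0 := fun u => by
      rw [Finset.inter_filter, Finset.inter_univ, Finset.card_filter]
      push_cast
      simp only [G.adj_comm]
    simp only [this]
    rw [Finset.sum_comm]
    have : ∀ v, (∑ u, if G.Adj v u then (1 : ℝ) else 0) = d := fun v => by
      rw [Finset.sum_boole, hG]
    simp only [this, Finset.sum_const, nsmul_eq_mul]
    ring
  rw [e1, e2] at hsum
  have e3 : (2 * (1 + X : ℝ[X]) ^ d - 1).eval x = 2 * (1 + x) ^ d - 1 := by simp
  have e4 : (2 * (1 + X : ℝ[X]) ^ d - 1).derivative.eval x = 2 * d * (1 + x) ^ (d - 1) := by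
    simp [derivative_pow]; ring
  rw [e3, e4]
  obtain ⟨m, rfl⟩ : ∃ m, d = m + 1 := ⟨d - 1, by omega⟩
  simp only [Nat.add_sub_cancel, pow_succ] at hsum ⊢
  set T := (1 + x) ^ m
  set δ : ℝ := ((m + 1 : ℕ) : ℝ)
  have e5 : Fintype.card V / (2 * δ) * (x * (2 * δ * T)) * Z = x * T * (Fintype.card V * Z) := by
    field_simp
  rw [e5]
  refine le_of_mul_le_mul_left ?_ hd'
  have e6 : x * ((1 + 1 / x) * D) = (1 + x) * D := by field_simp; ring
  have e7 : δ * x * T * (Fintype.card V * Z - (1 + 1 / x) * D) =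
    δ * x * T * (Fintype.card V * Z) - δ * T * (x * ((1 + 1 / x) * D)) := by ring
  rw [e7, e6] at hsum
  linarith

end IndependentSets

/-! ### Matchings: local identities at an edge -/

section Matchings

variable {V : Type*}

/-- No edge in `N` is incident to `v`. -/
def Avoids (N : Finset (Sym2 V)) (v : V) : Prop := ∀ e ∈ N, v ∉ e

/-- `N` is the edge set of a matching of `G`. -/
def IsEdgeMatching (G : SimpleGraph V) (N : Finset (Sym2 V)) : Prop :=
  (∀ e ∈ N, e ∈ G.edgeSet) ∧ ∀ e ∈ N, ∀ f ∈ N, ∀ v, v ∈ e → v ∈ f → e = f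

theorem IsEdgeMatching.subset {G : SimpleGraph V} {N N' : Finset (Sym2 V)}
    (h : IsEdgeMatching G N) (hN : N' ⊆ N) : IsEdgeMatching G N' :=
  ⟨fun e he => h.1 e (hN he), fun e he f hf => h.2 e (hN he) f (hN hf)⟩

theorem isEdgeMatching_insert {G : SimpleGraph V} [DecidableEq V] {N : Finset (Sym2 V)} {v w : V}
    (hN : IsEdgeMatching G N) (hvw : G.Adj v w) (hv : Avoids N v) (hw : Avoids N w) :
    IsEdgeMatching G (insert s(v, w) N) := by
  have hav : ∀ e ∈ N, ∀ z, z ∈ s(v, w) → z ∉ e := fun e he z hz => by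
    rcases Sym2.mem_iff.1 hz with rfl | rfl
    · exact hv e he
    · exact hw e he
  refine ⟨fun e he => ?_, fun e he f hf z hze hzf => ?_⟩
  · rcases Finset.mem_insert.1 he with rfl | he
    · exact hvw
    · exact hN.1 e he
  · rcases Finset.mem_insert.1 he with rfl | he' <;> rcases Finset.mem_insert.1 hf with rfl | hf'
    · rfl
    · exact absurd hzf (hav f hf' z hze)
    · exact absurd hze (hav e he' z hzf)
    · exact hN.2 e he' f hf' z hze hzf

theorem avoids_insert [DecidableEq V] {N : Finset (Sym2 V)} {v w z : V} :
    Avoids (insert s(v, w) N) z ↔ z ≠ v ∧ z ≠ w ∧ Avoids N z := by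
  simp only [Avoids, Finset.forall_mem_insert, Sym2.mem_iff, not_or, and_assoc, ne_eq]

theorem notMem_of_avoids {N : Finset (Sym2 V)} {v w : V} (h : Avoids N v) : s(v, w) ∉ N :=
  fun hN => h _ hN (Sym2.mem_mk_left v w)

theorem card_filter_not_avoids {G : SimpleGraph V} {N : Finset (Sym2 V)} [DecidableEq V]
    (hN : IsEdgeMatching G N) (S : Finset V) [DecidablePred (Avoids N)] :
    (S.filter fun v => ¬ Avoids N v).card = ∑ e ∈ N, (S.filter (· ∈ e)).card := by
  simp only [Finset.card_filter]
  rw [Finset.sum_comm]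
  refine Finset.sum_congr rfl fun v _ => ?_
  rw [← Finset.card_filter]
  by_cases h : Avoids N v
  · rw [if_neg (not_not.2 h)]
    symm
    rw [Finset.card_eq_zero, Finset.filter_eq_empty_iff]
    exact fun e he => h e he
  · rw [if_pos h]
    simp only [Avoids, not_forall, not_not] at h
    obtain ⟨e, he, hv⟩ := h
    symm
    rw [Finset.card_eq_one]
    refine ⟨e, ?_⟩
    ext f
    rw [Finset.mem_filter, Finset.mem_singleton]
    exact ⟨fun hf => hN.2 f hf.1 e he v hf.2 hv, by rintro rfl; exact ⟨he, hv⟩⟩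

variable [Fintype V]

open Classical in
/-- The finite family of edge sets of matchings. -/
noncomputable def edgeMatchings (G : SimpleGraph V) : Finset (Finset (Sym2 V)) :=
  Finset.univ.filter (IsEdgeMatching G)

theorem mem_edgeMatchings {G : SimpleGraph V} {N : Finset (Sym2 V)} :
    N ∈ edgeMatchings G ↔ IsEdgeMatching G N := by
  simp [edgeMatchings]

/-- The matching polynomial with nonnegative coefficients. -/
noncomputable def matchPoly (G : SimpleGraph V) : ℝ[X] :=
  ∑ N ∈ edgeMatchings G, X ^ N.card

theorem coeff_matchPoly (G : SimpleGraph V) (k : ℕ) :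
    (matchPoly G).coeff k = numMatchings G k := by
  classical
  rw [matchPoly, coeff_sum_X_pow_card, numMatchings, ← Set.ncard_coe_finset]
  congr 1
  symm
  refine Set.ncard_congr (fun M _ => M.edgeSet.toFinset) ?_ ?_ ?_
  · rintro M ⟨hM, hk⟩
    rw [Finset.mem_coe, Finset.mem_filter, mem_edgeMatchings, ← Set.ncard_eq_toFinset_card', hk]
    refine ⟨⟨fun e he => M.edgeSet_subset (Set.mem_toFinset.1 he), fun e he f hf v hve hvf => ?_⟩,
      rfl⟩
    rw [Set.mem_toFinset] at he hf
    obtain ⟨a, rfl⟩ := hve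
    obtain ⟨b, rfl⟩ := hvf
    rw [SimpleGraph.Subgraph.mem_edgeSet] at he hf
    rw [(hM (M.edge_vert he)).unique he hf]
  · rintro M M' ⟨hM, -⟩ ⟨hM', -⟩ h
    rw [Set.toFinset_inj] at h
    have hadj : M.Adj = M'.Adj := by
      ext a b
      rw [← SimpleGraph.Subgraph.mem_edgeSet, h, SimpleGraph.Subgraph.mem_edgeSet]
    refine SimpleGraph.Subgraph.ext ?_ hadj
    rw [← hM.support_eq_verts, ← hM'.support_eq_verts]
    ext a
    simp only [SimpleGraph.Subgraph.mem_support, hadj]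
  · intro N hN
    rw [Finset.mem_coe, Finset.mem_filter, mem_edgeMatchings] at hN
    obtain ⟨⟨hN1, hN2⟩, hk⟩ := hN
    let M : G.Subgraph :=
      { verts := {v | ∃ e ∈ N, v ∈ e}
        Adj := fun a b => s(a, b) ∈ N
        adj_sub := fun h => hN1 _ h
        edge_vert := fun h => ⟨_, h, Sym2.mem_mk_left _ _⟩
        symm := ⟨fun a b h => by rwa [Sym2.eq_swap]⟩ }
    have hE : M.edgeSet = (N : Set (Sym2 V)) := by
      ext e
      induction e with
      | _ a b => rfl
    refine ⟨M, ⟨fun v hv => ?_, ?_⟩, ?_⟩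
    · obtain ⟨e, he, w, rfl⟩ := hv
      refine ⟨w, he, fun w' hw' => ?_⟩
      exact (Sym2.congr_right.1 (hN2 _ he _ hw' v (Sym2.mem_mk_left _ _)
        (Sym2.mem_mk_left _ _))).symm
    · rw [hE, Set.ncard_coe_finset, hk]
    · simp only [hE, Finset.toFinset_coe]

open Classical in
/-- The neighbours of `v` which `N` does not cover. -/
noncomputable def freeNeighbors (G : SimpleGraph V) (N : Finset (Sym2 V)) (v : V) : Finset V :=
  Finset.univ.filter fun w => G.Adj v w ∧ Avoids N w

theorem mem_freeNeighbors {G : SimpleGraph V} {N : Finset (Sym2 V)} {v w : V} :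
    w ∈ freeNeighbors G N v ↔ G.Adj v w ∧ Avoids N w := by
  simp [freeNeighbors]

open Classical in
/-- Expanding a sum over matchings according to the edge at `v`. -/
theorem sum_edgeMatchings_expand (G : SimpleGraph V) (v : V) (f : Finset (Sym2 V) → ℝ) :
    ∑ Q ∈ edgeMatchings G, f Q = ∑ N ∈ edgeMatchings G with Avoids N v,
      (f N + ∑ w ∈ freeNeighbors G N v, f (insert s(v, w) N)) := by
  rw [← Finset.sum_filter_add_sum_filter_not _ (fun Q => Avoids Q v), Finset.sum_add_distrib]
  congr 1
  rw [Finset.sum_sigma']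
  symm
  refine Finset.sum_bij (fun P _ => insert s(v, P.2) P.1) ?_ ?_ ?_ (fun _ _ => rfl)
  · rintro ⟨N, w⟩ hP
    rw [Finset.mem_sigma, Finset.mem_filter, mem_edgeMatchings, mem_freeNeighbors] at hP
    obtain ⟨⟨hN, hv⟩, hvw, hw⟩ := hP
    rw [Finset.mem_filter, mem_edgeMatchings, avoids_insert]
    exact ⟨isEdgeMatching_insert hN hvw hv hw, fun h => h.1 rfl⟩
  · rintro ⟨N, w⟩ hP ⟨N', w'⟩ hP' h
    rw [Finset.mem_sigma, Finset.mem_filter] at hP hP'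
    simp only at h
    have hv := notMem_of_avoids (w := w) hP.1.2
    have hv' := notMem_of_avoids (w := w) hP'.1.2
    simp only at hv hv'
    have hmem : s(v, w) ∈ insert s(v, w') N' := h ▸ Finset.mem_insert_self _ _
    have heq : s(v, w) = s(v, w') := (Finset.mem_insert.1 hmem).resolve_right hv'
    obtain rfl : w = w' := Sym2.congr_right.1 heq
    rw [← Finset.erase_insert hv, h, Finset.erase_insert hv']
  · intro Q hQ
    rw [Finset.mem_filter, mem_edgeMatchings] at hQ
    obtain ⟨hQ, hv⟩ := hQ
    simp only [Avoids, not_forall, not_not] at hv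
    obtain ⟨e, he, w, rfl⟩ := hv
    have hav : ∀ z, z ∈ s(v, w) → Avoids (Q.erase s(v, w)) z := fun z hz e' he' hz' =>
      (Finset.mem_erase.1 he').1
        (hQ.2 e' (Finset.mem_erase.1 he').2 _ he z hz' hz)
    refine ⟨⟨Q.erase s(v, w), w⟩, ?_, Finset.insert_erase he⟩
    rw [Finset.mem_sigma, Finset.mem_filter, mem_edgeMatchings, mem_freeNeighbors]
    exact ⟨⟨hQ.subset (Finset.erase_subset _ _), hav v (Sym2.mem_mk_left v w)⟩, hQ.1 _ he,
      hav w (Sym2.mem_mk_right v w)⟩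

open Classical in
/-- The matchings avoiding both `u` and `v`. -/
noncomputable def pairAvoiding (G : SimpleGraph V) (u v : V) : Finset (Finset (Sym2 V)) :=
  (edgeMatchings G).filter fun N => Avoids N u ∧ Avoids N v

theorem pairAvoiding_comm (G : SimpleGraph V) (u v : V) :
    pairAvoiding G u v = pairAvoiding G v u := by
  classical
  ext N
  simp only [pairAvoiding, Finset.mem_filter, and_comm (a := Avoids N u)]

theorem mem_pairAvoiding {G : SimpleGraph V} {u v : V} {N : Finset (Sym2 V)} :
    N ∈ pairAvoiding G u v ↔ IsEdgeMatching G N ∧ Avoids N u ∧ Avoids N v := by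
  classical
  rw [pairAvoiding, Finset.mem_filter, mem_edgeMatchings]

open Classical in
/-- The number of neighbours of both `u` and `v` which `N` does not cover. -/
noncomputable def numCommonFree (G : SimpleGraph V) (N : Finset (Sym2 V)) (u v : V) : ℕ :=
  (freeNeighbors G N u ∩ freeNeighbors G N v).card

theorem numCommonFree_comm (G : SimpleGraph V) (N : Finset (Sym2 V)) (u v : V) :
    numCommonFree G N u v = numCommonFree G N v u := by
  classical
  rw [numCommonFree, numCommonFree, Finset.inter_comm]

theorem numCommonFree_eq_zero {G : SimpleGraph V} {u v : V} (N : Finset (Sym2 V))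
    (h : ∀ z, G.Adj u z → ¬ G.Adj v z) : numCommonFree G N u v = 0 := by
  classical
  rw [numCommonFree, Finset.card_eq_zero, Finset.eq_empty_iff_forall_notMem]
  intro z hz
  rw [Finset.mem_inter, mem_freeNeighbors, mem_freeNeighbors] at hz
  exact h z hz.1.1 hz.2.1

theorem numCommonFree_lt {G : SimpleGraph V} {N : Finset (Sym2 V)} {u v : V} (huv : G.Adj u v)
    (hv : Avoids N v) : numCommonFree G N u v + 1 ≤ (freeNeighbors G N u).card := by
  classical
  refine Finset.card_lt_card ⟨Finset.inter_subset_left, fun h => ?_⟩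
  have := (Finset.mem_inter.1 (h (mem_freeNeighbors.2 ⟨huv, hv⟩))).2
  exact (mem_freeNeighbors.1 this).1.ne rfl

open Classical in
-- Either `v` stays uncovered, or it is matched to a free neighbour `w ≠ u`. In the latter case `u`
-- loses the free neighbour `v`, and also `w` if `w` is one of the common ones. The truncated `- 2`
-- is harmless: its factor is nonzero only if a common free neighbour exists, and then `u` has at
-- least two free neighbours.
theorem sum_avoiding_expand (G : SimpleGraph V) {u v : V} (huv : G.Adj u v) (x : ℝ) (ψ : ℕ → ℝ) :
    ∑ Q ∈ edgeMatchings G with Avoids Q u, x ^ Q.card * ψ (freeNeighbors G Q u).card =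
      ∑ N ∈ pairAvoiding G u v, x ^ N.card *
        (ψ (freeNeighbors G N u).card + x *
          (((freeNeighbors G N v).card - 1 - numCommonFree G N u v) *
              ψ ((freeNeighbors G N u).card - 1) +
            numCommonFree G N u v * ψ ((freeNeighbors G N u).card - 2))) := by
  rw [Finset.sum_filter, sum_edgeMatchings_expand G v, pairAvoiding,
    ← Finset.filter_filter, Finset.filter_comm, Finset.sum_filter _ (s := Finset.filter _ _)]
  refine Finset.sum_congr rfl fun N hN => ?_
  rw [Finset.mem_filter, mem_edgeMatchings] at hN
  obtain ⟨hN, hv⟩ := hN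
  by_cases hu : Avoids N u
  swap
  · simp [hu, avoids_insert]
  rw [if_pos hu, if_pos hu, mul_add]
  congr 1
  have hvF : v ∈ freeNeighbors G N u := mem_freeNeighbors.2 ⟨huv, hv⟩
  have huF : u ∈ freeNeighbors G N v := mem_freeNeighbors.2 ⟨huv.symm, hu⟩
  have hfree : ∀ w, freeNeighbors G (insert s(v, w) N) u = (freeNeighbors G N u).erase v \ {w} := by
    intro w
    ext z
    simp only [mem_freeNeighbors, avoids_insert, Finset.mem_sdiff, Finset.mem_erase,
      Finset.mem_singleton]
    tauto
  have hterm : ∀ w ∈ (freeNeighbors G N v).erase u,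
      (if Avoids (insert s(v, w) N) u then x ^ (insert s(v, w) N).card *
        ψ (freeNeighbors G (insert s(v, w) N) u).card else 0) =
      x ^ N.card * x * (if w ∈ freeNeighbors G N u then ψ ((freeNeighbors G N u).card - 2)
        else ψ ((freeNeighbors G N u).card - 1)) := by
    intro w hw
    obtain ⟨hwu, hw⟩ := Finset.mem_erase.1 hw
    rw [if_pos (avoids_insert.2 ⟨huv.ne, hwu.symm, hu⟩),
      Finset.card_insert_of_notMem (notMem_of_avoids hv), pow_succ, hfree]
    congr 2
    split_ifs with hwF
    · have : w ∈ (freeNeighbors G N u).erase v :=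
        Finset.mem_erase.2 ⟨(mem_freeNeighbors.1 hw).1.ne.symm, hwF⟩
      rw [Finset.sdiff_singleton_eq_erase, Finset.card_erase_of_mem this,
        Finset.card_erase_of_mem hvF]
      rfl
    · rw [Finset.sdiff_singleton_eq_erase, Finset.erase_eq_of_notMem
        (fun h => hwF (Finset.mem_of_mem_erase h)), Finset.card_erase_of_mem hvF]
  rw [← Finset.add_sum_erase _ _ huF, if_neg (fun h => (avoids_insert.1 h).2.1 rfl), zero_add,
    Finset.sum_congr rfl hterm, ← Finset.mul_sum, Finset.sum_ite, Finset.sum_const,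
    Finset.sum_const, nsmul_eq_mul, nsmul_eq_mul]
  have hK : ((freeNeighbors G N v).erase u).filter (· ∈ freeNeighbors G N u) =
      freeNeighbors G N u ∩ freeNeighbors G N v := by
    ext w
    simp only [Finset.mem_filter, Finset.mem_erase, Finset.mem_inter, mem_freeNeighbors]
    exact ⟨fun h => ⟨h.2, h.1.2⟩, fun h => ⟨⟨h.1.1.ne.symm, h.2⟩, h.1⟩⟩
  have hK' := Finset.card_filter_add_card_filter_not (s := (freeNeighbors G N v).erase u)
    (· ∈ freeNeighbors G N u)
  rw [hK, Finset.card_erase_of_mem huF] at hK'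
  rw [hK]
  have hK2 : ((((freeNeighbors G N v).erase u).filter (· ∉ freeNeighbors G N u)).card : ℝ) =
      (freeNeighbors G N v).card - 1 - numCommonFree G N u v := by
    have h1 : 1 ≤ (freeNeighbors G N v).card := Finset.card_pos.2 ⟨u, huF⟩
    rw [← Nat.cast_one, ← Nat.cast_sub h1, ← hK', numCommonFree]
    push_cast
    ring
  rw [hK2, numCommonFree]
  ring

open Classical in
-- Counts pairs of a matching avoiding `u` and a free neighbour `v` of `u`.
theorem sum_avoiding_mul_card (G : SimpleGraph V) (u : V) (x : ℝ) (ψ : ℕ → ℝ) :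
    ∑ Q ∈ edgeMatchings G with Avoids Q u,
        x ^ Q.card * ((freeNeighbors G Q u).card * ψ (freeNeighbors G Q u).card) =
      ∑ v with G.Adj u v, ∑ N ∈ pairAvoiding G u v,
        x ^ N.card * ψ (freeNeighbors G N u).card := by
  have h : ∀ Q : Finset (Sym2 V),
      x ^ Q.card * ((freeNeighbors G Q u).card * ψ (freeNeighbors G Q u).card) =
      ∑ _v ∈ freeNeighbors G Q u, x ^ Q.card * ψ (freeNeighbors G Q u).card := fun Q => by
    rw [Finset.sum_const, nsmul_eq_mul]; ring
  simp only [h]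
  refine Finset.sum_comm' fun N v => ?_
  rw [mem_pairAvoiding, mem_freeNeighbors, Finset.mem_filter, Finset.mem_filter,
    mem_edgeMatchings]
  have := Finset.mem_univ v
  tauto

theorem sum_edgeMatchings_eq_avoiding (G : SimpleGraph V) (u : V) (x : ℝ)
    [DecidablePred (Avoids · u : Finset (Sym2 V) → Prop)] :
    ∑ Q ∈ edgeMatchings G, x ^ Q.card = ∑ N ∈ edgeMatchings G with Avoids N u,
      x ^ N.card * (1 + x * (freeNeighbors G N u).card) := by
  classical
  rw [sum_edgeMatchings_expand G u]
  refine Finset.sum_congr (by congr) fun N hN => ?_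
  have hu : Avoids N u := (Finset.mem_filter.1 hN).2
  rw [Finset.sum_congr rfl (g := fun _ => x ^ N.card * x) fun w _ => by
    rw [Finset.card_insert_of_notMem (notMem_of_avoids hu), pow_succ], Finset.sum_const,
    nsmul_eq_mul]
  ring

open Classical in
theorem two_mul_mul_derivative_matchPoly (G : SimpleGraph V) (x : ℝ) :
    2 * (x * (matchPoly G).derivative.eval x) =
      ∑ u, ∑ v with G.Adj u v, ∑ N ∈ pairAvoiding G u v, x ^ N.card * x := by
  have h1 : ∀ u, ∑ v with G.Adj u v, ∑ N ∈ pairAvoiding G u v, x ^ N.card * x =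
      ∑ Q ∈ edgeMatchings G with ¬ Avoids Q u, x ^ Q.card := by
    intro u
    have h := sum_avoiding_mul_card G u x fun _ => x
    have h2 := sum_edgeMatchings_eq_avoiding G u x
    rw [← Finset.sum_filter_add_sum_filter_not _ (fun Q => Avoids Q u)] at h2
    simp only [mul_add, mul_one, Finset.sum_add_distrib] at h2
    rw [← h, add_left_cancel h2]
    exact Finset.sum_congr rfl fun Q _ => by ring
  rw [Finset.sum_congr rfl fun u _ => h1 u, matchPoly, mul_derivative_eval_sum_X_pow_card,
    Finset.mul_sum]
  simp only [Finset.sum_filter (p := fun Q => ¬ Avoids Q _)]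
  rw [Finset.sum_comm]
  refine Finset.sum_congr rfl fun Q hQ => ?_
  have hQ' := mem_edgeMatchings.1 hQ
  rw [← Finset.sum_filter, Finset.sum_const, nsmul_eq_mul, card_filter_not_avoids hQ',
    Finset.sum_congr rfl (g := fun _ => 2), Finset.sum_const]
  · rw [smul_eq_mul]; push_cast; ring
  · intro e he
    have hadj := hQ'.1 e he
    induction e with
    | _ a b =>
      rw [show (Finset.univ.filter fun v => v ∈ s(a, b)) = {a, b} by ext; simp,
        Finset.card_pair hadj.ne]

/-- The bracket lists the extensions of `N` at `u` and `v`: none, an edge at `u` (possibly `uv`), an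
edge at `v` other than `uv`, or one at each end; in the last case the choices sharing a common
neighbour are excluded. -/
theorem matchPoly_eval_eq_sum_pairAvoiding (G : SimpleGraph V) {u v : V} (huv : G.Adj u v)
    (x : ℝ) :
    (matchPoly G).eval x = ∑ N ∈ pairAvoiding G u v, x ^ N.card *
      (1 + x * (freeNeighbors G N u).card + x * ((freeNeighbors G N v).card - 1) + x ^ 2 *
        (((freeNeighbors G N u).card - 1) * ((freeNeighbors G N v).card - 1) -
          numCommonFree G N u v)) := by
  classical
  have h := sum_avoiding_expand G huv x fun t => 1 + x * t
  rw [← sum_edgeMatchings_eq_avoiding] at h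
  rw [matchPoly, eval_finsetSum]
  simp only [eval_pow, eval_X]
  rw [h]
  refine Finset.sum_congr rfl fun N hN => ?_
  rw [mem_pairAvoiding] at hN
  have hK := numCommonFree_lt huv hN.2.2
  congr 1
  set a := (freeNeighbors G N u).card
  set K := numCommonFree G N u v
  obtain ⟨a', ha'⟩ : ∃ a', a = a' + 1 := ⟨a - 1, by omega⟩
  rcases Nat.eq_zero_or_pos K with hK0 | hK0
  · rw [hK0, ha']; push_cast [Nat.add_sub_cancel]; ring
  · obtain ⟨a'', rfl⟩ : ∃ a'', a' = a'' + 1 := ⟨a' - 1, by omega⟩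
    rw [ha', show a'' + 1 + 1 - 1 = a'' + 1 by omega, show a'' + 1 + 1 - 2 = a'' by omega]
    push_cast; ring

/-- The local constraint term of a dart whose ends see `a` and `b` free neighbours, `K` of them
common. -/
noncomputable def localConstraint (d : ℕ) (x : ℝ) (ψ : ℕ → ℝ) (a b K : ℕ) : ℝ :=
  (d - a) * ψ a - x * ((b - 1 - K) * (((a - 1 : ℕ) : ℝ) * ψ (a - 1)) +
    K * (((a - 2 : ℕ) : ℝ) * ψ (a - 2)))

open Classical in
-- The sum `A` is evaluated in two ways: by choosing a free neighbour of `u`, or, for each of the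
-- `d` neighbours `v` separately, by expanding at `v`. The difference of the two expressions for `d
-- * A` is zero.
theorem sum_localConstraint_eq_zero (G : SimpleGraph V) {d : ℕ} (u : V)
    (hu : (Finset.univ.filter (G.Adj u)).card = d) (x : ℝ) (ψ : ℕ → ℝ) :
    ∑ v with G.Adj u v, ∑ N ∈ pairAvoiding G u v, x ^ N.card *
      localConstraint d x ψ (freeNeighbors G N u).card (freeNeighbors G N v).card
        (numCommonFree G N u v) = 0 := by
  set A := ∑ Q ∈ edgeMatchings G with Avoids Q u,
        x ^ Q.card * ((freeNeighbors G Q u).card * ψ (freeNeighbors G Q u).card) with hA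
  have h1 := sum_avoiding_mul_card G u x ψ
  have h2 : ∑ v with G.Adj u v, ∑ N ∈ pairAvoiding G u v, x ^ N.card *
      ((freeNeighbors G N u).card * ψ (freeNeighbors G N u).card + x *
          (((freeNeighbors G N v).card - 1 - numCommonFree G N u v) *
              (((freeNeighbors G N u).card - 1 : ℕ) * ψ ((freeNeighbors G N u).card - 1)) +
            numCommonFree G N u v * (((freeNeighbors G N u).card - 2 : ℕ) *
              ψ ((freeNeighbors G N u).card - 2)))) = d * A := by
    rw [Finset.sum_congr rfl (g := fun _ => A), Finset.sum_const, hu, nsmul_eq_mul]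
    intro v hv
    exact (sum_avoiding_expand G (Finset.mem_filter.1 hv).2 x fun t => t * ψ t).symm
  rw [← hA] at h1
  have h3 : d * A - d * A = 0 := sub_self _
  nth_rw 1 [h1] at h3
  rw [← h2, Finset.mul_sum, ← Finset.sum_sub_distrib] at h3
  rw [← h3]
  refine Finset.sum_congr rfl fun v _ => ?_
  rw [Finset.mul_sum, ← Finset.sum_sub_distrib]
  refine Finset.sum_congr rfl fun N _ => ?_
  rw [localConstraint]
  ring

/-- The dual slack of a dart. -/
noncomputable def dualSlack (d : ℕ) (x α : ℝ) (ψ : ℕ → ℝ) (a b K : ℕ) : ℝ :=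
  x - α * (1 + x * a + x * (b - 1) + x ^ 2 * ((a - 1) * (b - 1) - K)) -
    (localConstraint d x ψ a b K + localConstraint d x ψ b a K) / 2

open Classical in
-- Weak duality: the constraint terms sum to zero in both orientations of the edges, so if `ψ` makes
-- the slack nonpositive everywhere, the mean size of a matching is at most `α` times the number of
-- edges.
theorem sum_dualSlack (G : SimpleGraph V) {d : ℕ}
    (hG : ∀ v, (Finset.univ.filter (G.Adj v)).card = d) (x α : ℝ) (ψ : ℕ → ℝ) :
    ∑ u, ∑ v with G.Adj u v, ∑ N ∈ pairAvoiding G u v, x ^ N.card *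
      dualSlack d x α ψ (freeNeighbors G N u).card (freeNeighbors G N v).card
        (numCommonFree G N u v) =
    2 * (x * (matchPoly G).derivative.eval x) -
      α * (Fintype.card V * d * (matchPoly G).eval x) := by
  have h1 : ∑ u, ∑ v with G.Adj u v, ∑ N ∈ pairAvoiding G u v, x ^ N.card *
      localConstraint d x ψ (freeNeighbors G N u).card (freeNeighbors G N v).card
        (numCommonFree G N u v) = 0 :=
    Finset.sum_eq_zero fun u _ => sum_localConstraint_eq_zero G u (hG u) x ψ
  have h2 : ∑ u, ∑ v with G.Adj u v, ∑ N ∈ pairAvoiding G u v, x ^ N.card *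
      localConstraint d x ψ (freeNeighbors G N v).card (freeNeighbors G N u).card
        (numCommonFree G N u v) = 0 := by
    rw [← h1, Finset.sum_comm' (s' := fun v => Finset.univ.filter (G.Adj v)) (t' := Finset.univ)]
    · simp only [pairAvoiding_comm G, numCommonFree_comm G]
    · intro u v; simp [G.adj_comm]
  have h3 : ∑ u, ∑ v with G.Adj u v, ∑ N ∈ pairAvoiding G u v, x ^ N.card *
      (1 + x * (freeNeighbors G N u).card + x * ((freeNeighbors G N v).card - 1) + x ^ 2 *
        (((freeNeighbors G N u).card - 1) * ((freeNeighbors G N v).card - 1) -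
          numCommonFree G N u v)) = Fintype.card V * d * (matchPoly G).eval x := by
    have : ∀ u, ∀ v ∈ Finset.univ.filter (G.Adj u), _ = (matchPoly G).eval x := fun u v hv =>
      (matchPoly_eval_eq_sum_pairAvoiding G (Finset.mem_filter.1 hv).2 x).symm
    rw [Finset.sum_congr rfl fun u _ => Finset.sum_congr rfl (this u)]
    simp only [Finset.sum_const, hG, Finset.card_univ, nsmul_eq_mul]
    ring
  rw [two_mul_mul_derivative_matchPoly, ← h3]
  have h4 : ∀ S1 S2 S3 S4 : ℝ, S3 = 0 → S4 = 0 → S1 - α * S2 = S1 - α * S2 - (S3 + S4) / 2 :=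
    fun _ _ _ _ h h' => by rw [h, h']; ring
  rw [h4 _ _ _ _ h1 h2]
  simp only [Finset.mul_sum, ← Finset.sum_add_distrib, ← Finset.sum_sub_distrib, Finset.sum_div]
  refine Finset.sum_congr rfl fun u _ => Finset.sum_congr rfl fun v _ =>
    Finset.sum_congr rfl fun N _ => ?_
  rw [dualSlack]
  ring

end Matchings

/-! ### The dual solution and the sign of the slack -/

section Dual

/-- The recursion for `v` cancels everything that depends on one end alone. What remains is an
interaction of the two ends, which vanishes when `a = b` and `K = 0`. -/
theorem dualSlack_eq {d : ℕ} {x α : ℝ} {v : ℕ → ℝ} {a b K : ℕ}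
    (ha : 1 ≤ a) (hb : 1 ≤ b) (hKa : K + 1 ≤ a) (hKb : K + 1 ≤ b)
    (hEa : ((d : ℝ) - a) * v a = a * (x - α * (1 + x * d + x * (a - 1)) + x * (a - 1) * v (a - 1)))
    (hEb : ((d : ℝ) - b) * v b = b * (x - α * (1 + x * d + x * (b - 1)) + x * (b - 1) * v (b - 1)))
    (hv : v 0 = 0) :
    dualSlack d x α (fun j => (α * x * j + v j) / j) a b K =
      -(x / 2) * (((a : ℝ) - b) * (v (a - 1) - v (b - 1)) +
        K * ((v (a - 1) - v (a - 2)) + (v (b - 1) - v (b - 2)))) := by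
  -- At `j = 0` the quotient is `0` by convention, which is consistent since `v 0 = 0`.
  have hw : ∀ j : ℕ, (j : ℝ) * ((α * x * j + v j) / j) = α * x * j + v j := fun j => by
    rcases Nat.eq_zero_or_pos j with rfl | hj
    · simp [hv]
    · have : (j : ℝ) ≠ 0 := by positivity
      field_simp
  have hψ : ∀ a : ℕ, 1 ≤ a →
      ((d : ℝ) - a) * v a = a * (x - α * (1 + x * d + x * (a - 1)) + x * (a - 1) * v (a - 1)) →
      ((d : ℝ) - a) * ((α * x * a + v a) / a) =
        x - α * (1 + x + 2 * x * (a - 1)) + x * (a - 1) * v (a - 1) := fun a ha h => by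
    have : (a : ℝ) ≠ 0 := by positivity
    rw [mul_div_assoc', div_eq_iff this, mul_add, h]
    ring
  have hK : ∀ a : ℕ, 1 ≤ a → K + 1 ≤ a →
      (K : ℝ) * (α * x * ((a - 2 : ℕ) : ℝ) + v (a - 2)) =
        K * (α * x * ((a : ℝ) - 2) + v (a - 2)) := fun a ha h => by
    rcases Nat.eq_zero_or_pos K with rfl | hK
    · simp
    · rw [Nat.cast_sub (by omega)]; norm_num
  simp only [dualSlack, localConstraint, hw, hψ a ha hEa, hψ b hb hEb, mul_add x, hK a ha hKa,
    hK b hb hKb]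
  rw [Nat.cast_sub ha, Nat.cast_sub hb, Nat.cast_one]
  ring

/-- The dual recursion has monotone solutions once it closes up at `d`. -/
theorem dual_recursion_mono {d : ℕ} {x α : ℝ} (hx : 0 < x) (hα : 0 < α) {v : ℕ → ℝ}
    (hE : ∀ j < d, ((d : ℝ) - 1 - j) * v (j + 1) =
      (j + 1) * (x - α * (1 + x * d + x * j) + x * j * v j)) (hv : v 0 = 0) :
    ∀ j, j + 1 < d → v j ≤ v (j + 1) := by
  set b : ℕ → ℝ := fun j => x + d / (j * (j + 1)) with hb
  have hb0 : ∀ j, 0 < b j := fun j => by positivity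
  -- The difference of two consecutive instances of the recursion, each normalized by its index.
  have hrec : ∀ j, 1 ≤ j → j < d → ((d : ℝ) - 1 - j) / (j + 1) * (v (j + 1) - v j) =
      x * (j - 1) * (v j - v (j - 1)) + (b j * v j - α * x) := by
    intro j hj hjd
    have h1 := hE j hjd
    have h2 := hE (j - 1) (by omega)
    rw [Nat.sub_add_cancel hj, Nat.cast_sub hj] at h2
    have hj0 : (0 : ℝ) < j := by exact_mod_cast hj
    have e1 : ((d : ℝ) - 1 - j) / (j + 1) * v (j + 1) =
        x - α * (1 + x * d + x * j) + x * j * v j := by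
      rw [div_mul_eq_mul_div, h1]; field_simp
    have e2 : ((d : ℝ) - j) / j * v j =
        x - α * (1 + x * d + x * (j - 1)) + x * (j - 1) * v (j - 1) := by
      rw [div_mul_eq_mul_div, div_eq_iff hj0.ne']
      push_cast at h2
      linear_combination h2
    have e3 : ((d : ℝ) - j) / j - (d - 1 - j) / (j + 1) = d / (j * (j + 1)) := by
      field_simp; ring
    simp only [hb, ← e3]
    linear_combination e1 - e2
  have hmono : ∀ j k, 1 ≤ j → j ≤ k → b k ≤ b j := fun j k hj hjk => by
    simp only [hb]
    have : (0 : ℝ) < j := by exact_mod_cast hj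
    gcongr
  by_contra! hcon
  -- Start at the first descent. If it is at `0`, then `v 1 < 0` and the start moves to `1`, where
  -- the difference equation begins; `j = 1` is allowed to be the last index.
  have hpos : ∃ j, 1 ≤ j ∧ j < d ∧ (j + 1 < d ∨ j = 1) ∧ (j + 1 < d → v (j + 1) < v j) ∧ b j * v j < α * x := by
    classical
    have hex : ∃ j, j + 1 < d ∧ v (j + 1) < v j := hcon
    obtain ⟨hj1, hj2⟩ := Nat.find_spec hex
    have hmin := fun m => Nat.find_min (m := m) hex
    set j := Nat.find hex
    rcases Nat.eq_zero_or_pos j with h0 | hj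
    · rw [h0, hv] at hj2
      rw [h0] at hj1
      refine ⟨1, le_rfl, hj1, Or.inr rfl, fun hd2 => ?_, ?_⟩
      · have := hrec 1 le_rfl hj1
        have h3 : b 1 * v 1 < 0 := mul_neg_of_pos_of_neg (hb0 1) hj2
        have h4 : (0 : ℝ) < ((d : ℝ) - 1 - (1 : ℕ)) / ((1 : ℕ) + 1) := by
          have : (2 : ℝ) < d := by exact_mod_cast hd2
          push_cast
          exact div_pos (by linarith) (by norm_num)
        have h5 : 0 < α * x := mul_pos hα hx
        have h6 : ((d : ℝ) - 1 - (1 : ℕ)) / ((1 : ℕ) + 1) * (v (1 + 1) - v 1) < 0 := by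
          rw [this]; push_cast; linarith
        have := neg_of_mul_neg_right h6 h4.le
        linarith
      · exact (mul_neg_of_pos_of_neg (hb0 1) hj2).trans (mul_pos hα hx)
    · refine ⟨j, hj, by omega, Or.inl hj1, fun _ => hj2, ?_⟩
      have h3 := hrec j hj (by omega)
      have h4 : v (j - 1) ≤ v j := by
        have := hmin (j - 1) (by omega)
        rw [Nat.sub_add_cancel hj] at this
        by_contra hlt
        exact this ⟨by omega, not_le.1 hlt⟩
      have hj1' : (j : ℝ) + 1 < d := by exact_mod_cast hj1
      have h5 : ((d : ℝ) - 1 - j) / (j + 1) * (v (j + 1) - v j) < 0 :=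
        mul_neg_of_pos_of_neg (div_pos (by linarith) (by positivity)) (by linarith)
      have h6 : 0 ≤ x * (j - 1) * (v j - v (j - 1)) :=
        mul_nonneg (mul_nonneg hx.le (sub_nonneg.2 (by exact_mod_cast hj))) (by linarith)
      linarith
  obtain ⟨j0, hj0, hj0d, hj0', hj0v, hj0b⟩ := hpos
  -- A descent persists: once `v` decreases, `b k * v k` stays below `α * x` because `b` decreases
  -- too, so the next difference is negative as well.
  have hall : ∀ k, j0 ≤ k → k < d → (k + 1 < d → v (k + 1) < v k) ∧ b k * v k < α * x ∧
      (j0 < k → v k < v (k - 1)) := by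
    intro k hk
    induction k, hk using Nat.le_induction with
    | base => exact fun _ => ⟨hj0v, hj0b, fun h => absurd h (lt_irrefl _)⟩
    | succ k hk ih =>
      intro hkd
      obtain ⟨i1, i2, -⟩ := ih (by omega)
      have hlt := i1 hkd
      have hbv : b (k + 1) * v (k + 1) < α * x := by
        rcases le_or_gt (v (k + 1)) 0 with hn | hp
        · exact (mul_nonpos_of_nonneg_of_nonpos (hb0 _).le hn).trans_lt (mul_pos hα hx)
        · calc b (k + 1) * v (k + 1) ≤ b k * v (k + 1) := by
                have := hmono k (k + 1) (by omega) (by omega); gcongr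
            _ ≤ b k * v k := by have := hb0 k; gcongr
            _ < α * x := i2
      refine ⟨fun hkd2 => ?_, hbv, fun _ => hlt⟩
      have h3 := hrec (k + 1) (by omega) hkd
      rw [Nat.add_sub_cancel] at h3
      have h4 : x * (((k + 1 : ℕ) : ℝ) - 1) * (v (k + 1) - v k) ≤ 0 :=
        mul_nonpos_of_nonneg_of_nonpos (mul_nonneg hx.le (by push_cast; simp)) (by linarith)
      have hkd2' : ((k + 1 : ℕ) : ℝ) + 1 < d := by exact_mod_cast hkd2
      have h5 : 0 < ((d : ℝ) - 1 - (k + 1 : ℕ)) / ((k + 1 : ℕ) + 1) :=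
        div_pos (by linarith) (by positivity)
      have h6 : ((d : ℝ) - 1 - (k + 1 : ℕ)) / ((k + 1 : ℕ) + 1) * (v (k + 1 + 1) - v (k + 1)) < 0 := by
        rw [h3]; linarith
      have := neg_of_mul_neg_right h6 h5.le
      linarith
  -- At the last index `m = d - 1` the left side of the difference equation vanishes, while the
  -- right side is negative.
  obtain ⟨m, rfl⟩ : ∃ m, d = m + 1 := ⟨d - 1, by omega⟩
  obtain ⟨-, i2, i3⟩ := hall m (by omega) (by omega)
  have h3 := hrec m (by omega) (by omega)
  have h4 : (((m + 1 : ℕ) : ℝ) - 1 - m) / (m + 1) * (v (m + 1) - v m) = 0 := by push_cast; simp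
  rw [h4] at h3
  have h5 : x * ((m : ℝ) - 1) * (v m - v (m - 1)) ≤ 0 := by
    have hm1 : (1 : ℝ) ≤ m := by exact_mod_cast (by omega : 1 ≤ m)
    rcases (show j0 ≤ m by omega).eq_or_lt with h | h
    · obtain rfl : m = 1 := by omega
      simp
    · exact mul_nonpos_of_nonneg_of_nonpos (mul_nonneg hx.le (by linarith)) (by linarith [i3 h])
  linarith

/-- For monotone `v`, the product `(a - b) * (v (a - 1) - v (b - 1))` and the increments multiplied
by `K` are all nonnegative. -/
theorem dualSlack_nonpos {d : ℕ} {x α : ℝ} (hx : 0 < x) (hα : 0 < α) {v : ℕ → ℝ}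
    (hE : ∀ j < d, ((d : ℝ) - 1 - j) * v (j + 1) =
      (j + 1) * (x - α * (1 + x * d + x * j) + x * j * v j)) (hv : v 0 = 0) {a b K : ℕ}
    (had : a ≤ d) (hbd : b ≤ d) (hKa : K + 1 ≤ a) (hKb : K + 1 ≤ b) :
    dualSlack d x α (fun j => (α * x * j + v j) / j) a b K ≤ 0 := by
  have hE' : ∀ a : ℕ, 1 ≤ a → a ≤ d →
      ((d : ℝ) - a) * v a = a * (x - α * (1 + x * d + x * (a - 1)) + x * (a - 1) * v (a - 1)) := by
    intro a ha had
    obtain ⟨j, rfl⟩ : ∃ j, a = j + 1 := ⟨a - 1, by omega⟩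
    have := hE j (by omega)
    rw [Nat.add_sub_cancel]
    push_cast
    linear_combination this
  have hmono := dual_recursion_mono hx hα hE hv
  have hmono' : ∀ i j, i ≤ j → j < d → v i ≤ v j := fun i j hij => by
    induction j, hij using Nat.le_induction with
    | base => exact fun _ => le_rfl
    | succ j _ ih => exact fun h => (ih (by omega)).trans (hmono j h)
  rw [dualSlack_eq (by omega) (by omega) hKa hKb (hE' a (by omega) had) (hE' b (by omega) hbd) hv]
  have h1 : 0 ≤ ((a : ℝ) - b) * (v (a - 1) - v (b - 1)) := by
    rcases le_total a b with hab | hab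
    · exact mul_nonneg_of_nonpos_of_nonpos (sub_nonpos.2 (by exact_mod_cast hab))
        (sub_nonpos.2 (hmono' _ _ (by omega) (by omega)))
    · exact mul_nonneg (sub_nonneg.2 (by exact_mod_cast hab))
        (sub_nonneg.2 (hmono' _ _ (by omega) (by omega)))
  have h2 := hmono' (a - 2) (a - 1) (by omega) (by omega)
  have h3 := hmono' (b - 2) (b - 1) (by omega) (by omega)
  have h4 : 0 ≤ (K : ℝ) * ((v (a - 1) - v (a - 2)) + (v (b - 1) - v (b - 2))) :=
    mul_nonneg K.cast_nonneg (by linarith)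
  have := mul_nonneg hx.le (add_nonneg h1 h4)
  linarith

end Dual

/-! ### The extremal graph `K_{d,d}` and the bound for matchings -/

section CompleteBipartite

theorem isEdgeMatching_empty {V : Type*} (G : SimpleGraph V) : IsEdgeMatching G ∅ :=
  ⟨by simp, by simp⟩

theorem card_filter_avoids_add {V : Type*} {G : SimpleGraph V} {N : Finset (Sym2 V)}
    [DecidableEq V] (hN : IsEdgeMatching G N) (S : Finset V) [DecidablePred (Avoids N)]
    (hS : ∀ e ∈ N, (S.filter (· ∈ e)).card = 1) :
    (S.filter (Avoids N)).card + N.card = S.card := by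
  have h := card_filter_not_avoids hN S
  rw [Finset.sum_congr rfl hS, Finset.sum_const, smul_eq_mul, mul_one] at h
  rw [← h, Finset.card_filter_add_card_filter_not]

variable {d : ℕ}

theorem card_map_inl_filter_mem {e : Sym2 (Fin d ⊕ Fin d)}
    (he : e ∈ (completeBipartiteGraph (Fin d) (Fin d)).edgeSet) :
    (((Finset.univ : Finset (Fin d)).map Function.Embedding.inl).filter (· ∈ e)).card = 1 := by
  induction e with
  | _ a b =>
    rw [SimpleGraph.mem_edgeSet] at he
    rw [Finset.card_eq_one]
    rcases a with a | a <;> rcases b with b | b <;> simp at he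
    · exact ⟨Sum.inl a, by ext z; rcases z with z | z <;> simp⟩
    · exact ⟨Sum.inl b, by ext z; rcases z with z | z <;> simp⟩

theorem card_map_inr_filter_mem {e : Sym2 (Fin d ⊕ Fin d)}
    (he : e ∈ (completeBipartiteGraph (Fin d) (Fin d)).edgeSet) :
    (((Finset.univ : Finset (Fin d)).map Function.Embedding.inr).filter (· ∈ e)).card = 1 := by
  induction e with
  | _ a b =>
    rw [SimpleGraph.mem_edgeSet] at he
    rw [Finset.card_eq_one]
    rcases a with a | a <;> rcases b with b | b <;> simp at he
    · exact ⟨Sum.inr b, by ext z; rcases z with z | z <;> simp⟩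
    · exact ⟨Sum.inr a, by ext z; rcases z with z | z <;> simp⟩

/-- Every edge of the matching uses one vertex on each side, so in `K_{d,d}` both ends of an edge
always see equally many free neighbours. -/
theorem card_freeNeighbors_add {N : Finset (Sym2 (Fin d ⊕ Fin d))}
    (hN : IsEdgeMatching (completeBipartiteGraph (Fin d) (Fin d)) N) (u : Fin d ⊕ Fin d) :
    (freeNeighbors (completeBipartiteGraph (Fin d) (Fin d)) N u).card + N.card = d := by
  classical
  rcases u with u | u
  · have h := card_filter_avoids_add hN _ fun e he => card_map_inr_filter_mem (hN.1 e he)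
    rw [Finset.card_map, Finset.card_univ, Fintype.card_fin] at h
    refine Eq.trans ?_ h
    congr 2
    ext z; rcases z with z | z <;> simp [mem_freeNeighbors]
  · have h := card_filter_avoids_add hN _ fun e he => card_map_inl_filter_mem (hN.1 e he)
    rw [Finset.card_map, Finset.card_univ, Fintype.card_fin] at h
    refine Eq.trans ?_ h
    congr 2
    ext z; rcases z with z | z <;> simp [mem_freeNeighbors]

theorem numCommonFree_completeBipartiteGraph (N : Finset (Sym2 (Fin d ⊕ Fin d)))
    {u v : Fin d ⊕ Fin d} (huv : (completeBipartiteGraph (Fin d) (Fin d)).Adj u v) :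
    numCommonFree (completeBipartiteGraph (Fin d) (Fin d)) N u v = 0 := by
  refine numCommonFree_eq_zero N fun z h1 h2 => ?_
  rcases u with u | u <;> rcases v with v | v <;> rcases z with z | z <;> simp at huv h1 h2

theorem card_le_of_isEdgeMatching {N : Finset (Sym2 (Fin d ⊕ Fin d))}
    (hN : IsEdgeMatching (completeBipartiteGraph (Fin d) (Fin d)) N) (hd : 1 ≤ d) : N.card ≤ d := by
  have := card_freeNeighbors_add hN (Sum.inl ⟨0, hd⟩)
  omega

theorem one_le_coeff_matchPoly {k : ℕ} (hk : k ≤ d) :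
    1 ≤ (matchPoly (completeBipartiteGraph (Fin d) (Fin d))).coeff k := by
  classical
  rw [matchPoly, coeff_sum_X_pow_card, Nat.one_le_cast, Nat.one_le_iff_ne_zero,
    Finset.card_ne_zero]
  have hinj : Function.Injective fun i : Fin d => s((Sum.inl i : Fin d ⊕ Fin d), Sum.inr i) := by
    intro i j h
    simpa using h
  refine ⟨(Finset.univ.filter fun i : Fin d => i.val < k).map ⟨_, hinj⟩, ?_⟩
  rw [Finset.mem_filter, mem_edgeMatchings, Finset.card_map]
  refine ⟨⟨fun e he => ?_, fun e he f hf v hve hvf => ?_⟩, ?_⟩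
  · obtain ⟨i, -, rfl⟩ := Finset.mem_map.1 he
    simp
  · obtain ⟨i, -, rfl⟩ := Finset.mem_map.1 he
    obtain ⟨j, -, rfl⟩ := Finset.mem_map.1 hf
    simp only [Function.Embedding.coeFn_mk, Sym2.mem_iff] at hve hvf ⊢
    rcases hve with rfl | rfl <;> simp at hvf <;> rw [hvf]
  · rw [Fin.card_filter_val_lt]
    omega

theorem natDegree_matchPoly_le (hd : 1 ≤ d) :
    (matchPoly (completeBipartiteGraph (Fin d) (Fin d))).natDegree ≤ d := by
  refine natDegree_sum_le_of_forall_le _ _ fun N hN => ?_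
  rw [natDegree_X_pow]
  exact card_le_of_isEdgeMatching (mem_edgeMatchings.1 hN) hd

theorem coeff_matchPoly_nonneg {V : Type*} [Fintype V] (G : SimpleGraph V) (k : ℕ) :
    0 ≤ (matchPoly G).coeff k := by
  rw [coeff_matchPoly]; positivity

theorem coeff_zero_matchPoly {V : Type*} [Fintype V] (G : SimpleGraph V) :
    (matchPoly G).coeff 0 = 1 := by
  classical
  rw [matchPoly, coeff_sum_X_pow_card]
  have : (edgeMatchings G).filter (·.card = 0) = {∅} := by
    ext A
    simp only [Finset.mem_filter, Finset.card_eq_zero, Finset.mem_singleton, mem_edgeMatchings]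
    exact ⟨fun h => h.2, fun h => ⟨h ▸ isEdgeMatching_empty G, h⟩⟩
  rw [this]; simp

open Classical in
theorem degree_completeBipartiteGraph (u : Fin d ⊕ Fin d) :
    (Finset.univ.filter ((completeBipartiteGraph (Fin d) (Fin d)).Adj u)).card = d := by
  have h := card_freeNeighbors_add (isEdgeMatching_empty _) u
  rw [Finset.card_empty, add_zero] at h
  refine Eq.trans ?_ h
  congr 1
  ext v
  simp [mem_freeNeighbors, Avoids]

/-- The dual recursion, started at `0`. -/
noncomputable def dualSeq (d : ℕ) (x α : ℝ) : ℕ → ℝ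
  | 0 => 0
  -- At `j + 1 = d` the division by zero returns `0`; that value is only ever multiplied by `d - d`.
  | j + 1 => (j + 1) * (x - α * (1 + x * d + x * j) + x * j * dualSeq d x α j) / (d - 1 - j)

open Classical in
-- For `j = d - 1` the left side vanishes, and the claim is a condition on `α`. It follows from
-- `sum_dualSlack` for `K_{d,d}` itself: the slack of every nonempty `N` vanishes by the earlier
-- steps of the recursion and the total vanishes by the choice of `α`. Hence the slack of `N = ∅`,
-- where `a = b = d`, is zero too.
theorem dualSeq_closes (hd : 1 ≤ d) {x α : ℝ}
    (hα : 2 * (x * (matchPoly (completeBipartiteGraph (Fin d) (Fin d))).derivative.eval x) =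
      α * ((d + d : ℕ) * d * (matchPoly (completeBipartiteGraph (Fin d) (Fin d))).eval x))
    (j : ℕ) (hj : j < d) : ((d : ℝ) - 1 - j) * dualSeq d x α (j + 1) =
      (j + 1) * (x - α * (1 + x * d + x * j) + x * j * dualSeq d x α j) := by
  have hlt : ∀ j : ℕ, j + 1 < d → ((d : ℝ) - 1 - j) * dualSeq d x α (j + 1) =
      (j + 1) * (x - α * (1 + x * d + x * j) + x * j * dualSeq d x α j) := fun j hj => by
    have : (j : ℝ) + 1 < d := by exact_mod_cast hj
    have : (d : ℝ) - 1 - j ≠ 0 := by linarith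
    rw [dualSeq]
    field_simp
  rcases Nat.lt_or_ge (j + 1) d with h | h
  · exact hlt j h
  obtain rfl : d = j + 1 := by omega
  set G := completeBipartiteGraph (Fin (j + 1)) (Fin (j + 1)) with hG
  set v := dualSeq (j + 1) x α with hv
  set ψ : ℕ → ℝ := fun j => (α * x * j + v j) / j with hψ
  set r := dualSlack (j + 1) x α ψ (j + 1) (j + 1) 0 with hr
  have hfree : ∀ N, IsEdgeMatching G N → ∀ u, (freeNeighbors G N u).card + N.card = j + 1 :=
    fun N hN u => card_freeNeighbors_add hN u
  have hdeg : ∀ u, (Finset.univ.filter (G.Adj u)).card = j + 1 := degree_completeBipartiteGraph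
  have hcommon : ∀ N, ∀ u w, G.Adj u w → numCommonFree G N u w = 0 := fun N u w h =>
    numCommonFree_completeBipartiteGraph N h
  have hsum := sum_dualSlack G degree_completeBipartiteGraph x α ψ
  rw [Fintype.card_sum, Fintype.card_fin, hα, sub_self] at hsum
  have hterm : ∀ u, ∀ w ∈ Finset.univ.filter (G.Adj u), ∀ N ∈ pairAvoiding G u w,
      x ^ N.card * dualSlack (j + 1) x α ψ (freeNeighbors G N u).card (freeNeighbors G N w).card
        (numCommonFree G N u w) = if N = ∅ then r else 0 := by
    intro u w hw N hN
    have huw := (Finset.mem_filter.1 hw).2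
    rw [mem_pairAvoiding] at hN
    have ha := hfree N hN.1 u
    have hb := hfree N hN.1 w
    have hpos := numCommonFree_lt huw hN.2.2
    rw [hcommon N u w huw] at hpos ⊢
    have hab : (freeNeighbors G N w).card = (freeNeighbors G N u).card := by omega
    rw [hab]
    split_ifs with h0
    · have : (freeNeighbors G N u).card = j + 1 := by rw [h0, Finset.card_empty] at ha; rwa [h0]
      rw [this, h0]; simp [hr]
    · have hcard : N.card ≠ 0 := fun h => h0 (Finset.card_eq_zero.1 h)
      obtain ⟨a, ha'⟩ : ∃ a, (freeNeighbors G N u).card = a + 1 :=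
        ⟨(freeNeighbors G N u).card - 1, by omega⟩
      have hE := hlt a (by omega)
      have hE' : (((j + 1 : ℕ) : ℝ) - (a + 1 : ℕ)) * v (a + 1) = ((a + 1 : ℕ) : ℝ) *
          (x - α * (1 + x * (j + 1 : ℕ) + x * ((a + 1 : ℕ) - 1)) +
            x * ((a + 1 : ℕ) - 1) * v (a + 1 - 1)) := by
        rw [Nat.add_sub_cancel]
        push_cast at hE ⊢
        linear_combination hE
      rw [ha', hψ, dualSlack_eq (by omega) (by omega) (by omega) (by omega) hE' hE' rfl]
      simp
  rw [Finset.sum_congr rfl fun u _ => Finset.sum_congr rfl fun w hw =>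
    Finset.sum_congr rfl (hterm u w hw)] at hsum
  have hempty : ∀ u w, ∑ N ∈ pairAvoiding G u w, (if N = ∅ then r else 0) = r := fun u w => by
    rw [Finset.sum_ite_eq', if_pos]
    rw [mem_pairAvoiding]
    exact ⟨isEdgeMatching_empty G, by simp [Avoids], by simp [Avoids]⟩
  simp only [hempty, Finset.sum_const, hdeg, nsmul_eq_mul, Finset.card_univ,
    Fintype.card_sum, Fintype.card_fin] at hsum
  have hr0 : r = 0 := by
    have h1 : ((j + 1 + (j + 1) : ℕ) : ℝ) ≠ 0 := by positivity
    have h2 : ((j + 1 : ℕ) : ℝ) ≠ 0 := by positivity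
    exact (mul_eq_zero.1 ((mul_eq_zero.1 hsum).resolve_left h1)).resolve_left h2
  have hw : (j : ℝ) * ψ j = α * x * j + v j := by
    rcases Nat.eq_zero_or_pos j with h0 | hj
    · simp [hψ, h0, hv, dualSeq]
    · have : (j : ℝ) ≠ 0 := by positivity
      simp only [hψ]
      field_simp
  rw [hr, dualSlack, localConstraint, Nat.add_sub_cancel, hw] at hr0
  push_cast at hr0 ⊢
  linear_combination -(j + 1 : ℝ) * hr0

open Classical in
theorem matchPoly_log_derivative_le {V : Type*} [Fintype V] (G : SimpleGraph V) (hd : 1 ≤ d)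
    (hG : ∀ v, (Finset.univ.filter (G.Adj v)).card = d) {x : ℝ} (hx : 0 < x) :
    x * (matchPoly G).derivative.eval x *
        (matchPoly (completeBipartiteGraph (Fin d) (Fin d))).eval x ≤
      Fintype.card V / (2 * d) *
        (x * (matchPoly (completeBipartiteGraph (Fin d) (Fin d))).derivative.eval x) *
        (matchPoly G).eval x := by
  set p := matchPoly (completeBipartiteGraph (Fin d) (Fin d)) with hp
  have hd' : (0 : ℝ) < d := by exact_mod_cast hd
  have hP : 0 < p.eval x := eval_pos_of_coeff_nonneg (coeff_matchPoly_nonneg _)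
    (by rw [coeff_zero_matchPoly]; norm_num) hx.le
  -- The probability that a given edge of `K_{d,d}` lies in the random matching with weights `x ^
  -- N.card`.
  set α := x * p.derivative.eval x / (d ^ 2 * p.eval x) with hα
  have hD : 0 < x * p.derivative.eval x := by
    rw [mul_derivative_eval (natDegree_matchPoly_le hd)]
    refine Finset.sum_pos' (fun k _ => ?_) ⟨1, by simp; omega, ?_⟩
    · have := coeff_matchPoly_nonneg (completeBipartiteGraph (Fin d) (Fin d)) k
      positivity
    · have := one_le_coeff_matchPoly hd
      rw [Nat.cast_one, one_mul, pow_one]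
      exact mul_pos (by linarith) hx
  have hα0 : 0 < α := by positivity
  have hclose := dualSeq_closes hd (x := x) (α := α) (by
    rw [← hp, hα]; push_cast; field_simp; ring)
  have hsum := sum_dualSlack G hG x α fun j => (α * x * j + dualSeq d x α j) / j
  have hle := hsum.symm.trans_le (Finset.sum_nonpos fun u _ => Finset.sum_nonpos fun v hv =>
    Finset.sum_nonpos fun N hN => mul_nonpos_of_nonneg_of_nonpos (pow_pos hx _).le ?_)
  · have e : α * (Fintype.card V * d * (matchPoly G).eval x) * p.eval x =
        2 * (Fintype.card V / (2 * d) * (x * p.derivative.eval x) * (matchPoly G).eval x) := by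
      rw [hα]; field_simp
    have := mul_le_mul_of_nonneg_right hle hP.le
    rw [zero_mul, sub_mul, e] at this
    linarith
  · have huv := (Finset.mem_filter.1 hv).2
    rw [mem_pairAvoiding] at hN
    have hcard : ∀ u, (freeNeighbors G N u).card ≤ d := fun u => by
      rw [← hG u]
      exact Finset.card_le_card fun w hw =>
        Finset.mem_filter.2 ⟨Finset.mem_univ w, (mem_freeNeighbors.1 hw).1⟩
    exact dualSlack_nonpos hx hα0 hclose rfl (hcard u) (hcard v) (numCommonFree_lt huv hN.2.2)
      (numCommonFree_comm G N u v ▸ numCommonFree_lt huv.symm hN.2.1)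

theorem matchPoly_prod {V ι : Type*} [Fintype V] [Fintype ι] (G : SimpleGraph V)
    (H : SimpleGraph (ι × V)) (hH : ∀ x y, H.Adj x y ↔ x.1 = y.1 ∧ G.Adj x.2 y.2) :
    matchPoly H = matchPoly G ^ Fintype.card ι := by
  classical
  set g : (_ : ι) × Sym2 V → Sym2 (ι × V) := fun P => P.2.map fun v => (P.1, v) with hg
  have hmem : ∀ i (e : Sym2 V) z, z ∈ g ⟨i, e⟩ ↔ z.1 = i ∧ z.2 ∈ e := by
    rintro i e ⟨j, z⟩
    simp only [hg, Sym2.mem_map, Prod.mk.injEq]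
    constructor
    · rintro ⟨a, ha, rfl, rfl⟩; exact ⟨rfl, ha⟩
    · rintro ⟨rfl, h⟩; exact ⟨z, h, rfl, rfl⟩
  have hginj : Function.Injective g := by
    rintro ⟨i, e⟩ ⟨j, f⟩ h
    obtain rfl : i = j := by
      induction e with
      | _ a b =>
        have : (i, a) ∈ g ⟨i, s(a, b)⟩ := (hmem _ _ _).2 ⟨rfl, Sym2.mem_mk_left a b⟩
        rw [h, hmem] at this
        exact this.1
    congr 1
    exact Sym2.map.injective (fun a b hab => (Prod.mk.inj hab).2) h
  have hedge : ∀ i e, g ⟨i, e⟩ ∈ H.edgeSet ↔ e ∈ G.edgeSet := fun i e => by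
    induction e with
    | _ a b => simp [hg, hH]
  have hsurj : ∀ e ∈ H.edgeSet, ∃ P, g P = e := fun e he => by
    induction e with
    | _ a b =>
      rw [SimpleGraph.mem_edgeSet, hH] at he
      refine ⟨⟨a.1, s(a.2, b.2)⟩, ?_⟩
      simp only [hg, Sym2.map_mk]
      rw [show (a.1, b.2) = b from Prod.ext he.1 rfl]
  rw [matchPoly, matchPoly, ← Finset.card_univ, ← Finset.prod_const, Finset.prod_univ_sum]
  symm
  refine Finset.sum_bij' (fun f _ => (Finset.univ.sigma f).map ⟨g, hginj⟩)
    (fun S _ i => Finset.univ.filter fun e => g ⟨i, e⟩ ∈ S) ?_ ?_ ?_ ?_ ?_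
  · intro f hf
    rw [Fintype.mem_piFinset] at hf
    rw [mem_edgeMatchings]
    refine ⟨fun e he => ?_, fun e he e' he' z hz hz' => ?_⟩
    · obtain ⟨⟨i, e⟩, hP, rfl⟩ := Finset.mem_map.1 he
      exact (hedge i e).2 ((mem_edgeMatchings.1 (hf i)).1 e (Finset.mem_sigma.1 hP).2)
    · obtain ⟨⟨i, e⟩, hP, rfl⟩ := Finset.mem_map.1 he
      obtain ⟨⟨j, e'⟩, hP', rfl⟩ := Finset.mem_map.1 he'
      obtain ⟨rfl, hze⟩ := (hmem _ _ _).1 hz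
      obtain ⟨rfl, hze'⟩ := (hmem _ _ _).1 hz'
      rw [(mem_edgeMatchings.1 (hf z.1)).2 e (Finset.mem_sigma.1 hP).2 e'
        (Finset.mem_sigma.1 hP').2 z.2 hze hze']
  · intro S hS
    rw [mem_edgeMatchings] at hS
    rw [Fintype.mem_piFinset]
    intro i
    rw [mem_edgeMatchings]
    refine ⟨fun e he => ?_, fun e he e' he' z hz hz' => ?_⟩
    · exact (hedge i e).1 (hS.1 _ (Finset.mem_filter.1 he).2)
    · have := hS.2 _ (Finset.mem_filter.1 he).2 _ (Finset.mem_filter.1 he').2 (i, z)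
        ((hmem _ _ _).2 ⟨rfl, hz⟩) ((hmem _ _ _).2 ⟨rfl, hz'⟩)
      simpa using hginj this
  · intro f _
    ext i e
    simp only [Finset.mem_filter, Finset.mem_univ, true_and, Finset.mem_map,
      Function.Embedding.coeFn_mk, Finset.mem_sigma]
    constructor
    · rintro ⟨P, hP, h⟩
      obtain rfl := hginj h
      exact hP
    · exact fun h => ⟨_, h, rfl⟩
  · intro S hS
    ext e
    simp only [Finset.mem_filter, Finset.mem_univ, true_and, Finset.mem_map,
      Function.Embedding.coeFn_mk, Finset.mem_sigma]
    constructor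
    · rintro ⟨P, hP, rfl⟩; exact hP
    · intro he
      obtain ⟨P, rfl⟩ := hsurj e ((mem_edgeMatchings.1 hS).1 e he)
      exact ⟨P, he, rfl⟩
  · intro f _
    rw [Finset.prod_pow_eq_pow_sum, Finset.card_map, Finset.card_sigma]

end CompleteBipartite

/-! ### From polynomials to coefficients, and the main theorem -/

theorem log_add_mul_log_le {p : ℝ[X]} {c k : ℕ} {b x : ℝ} (hp : ∀ i, 0 ≤ p.coeff i)
    (hc : p.coeff k = c) (hpos : 0 < c) (hx : 0 < x) (h : Real.log (p.eval x) ≤ b) :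
    Real.log c + k * Real.log x ≤ b := by
  have hc' : (0 : ℝ) < c := by exact_mod_cast hpos
  refine le_trans ?_ h
  rw [← Real.log_pow, ← Real.log_mul hc'.ne' (pow_pos hx k).ne', ← hc]
  exact Real.log_le_log (by rw [hc]; positivity) (coeff_mul_pow_le_eval hp hx.le k)

open Classical in
theorem card_filter_adj_eq {V : Type*} [Fintype V] {G : SimpleGraph V} [G.LocallyFinite] {d : ℕ}
    (hG : G.IsRegularOfDegree d) (v : V) : (Finset.univ.filter (G.Adj v)).card = d := by
  rw [← hG v, ← SimpleGraph.card_neighborFinset_eq_degree]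
  congr 1
  ext w
  simp

theorem log_eval_matchPoly_le {V : Type*} [Fintype V] (G : SimpleGraph V) [G.LocallyFinite] {d : ℕ}
    (hd : 1 ≤ d) (hG : G.IsRegularOfDegree d) {x : ℝ} (hx : 0 < x) :
    Real.log ((matchPoly G).eval x) ≤ Fintype.card V / (2 * d) *
      Real.log ((matchPoly (completeBipartiteGraph (Fin d) (Fin d))).eval x) :=
  log_eval_le_of_log_derivative_le (coeff_matchPoly_nonneg _) (coeff_zero_matchPoly _)
    (coeff_matchPoly_nonneg _) (coeff_zero_matchPoly _)
    (fun _ hy => matchPoly_log_derivative_le G hd (card_filter_adj_eq hG) hy) hx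

theorem coeff_indepPoly_nonneg {V : Type*} [Fintype V] (G : SimpleGraph V) (k : ℕ) :
    0 ≤ (indepPoly G).coeff k := by
  rw [coeff_indepPoly]; positivity

theorem coeff_zero_indepPoly {V : Type*} [Fintype V] (G : SimpleGraph V) :
    (indepPoly G).coeff 0 = 1 := by
  classical
  rw [indepPoly, coeff_sum_X_pow_card]
  have : (indepSets G).filter (·.card = 0) = {∅} := by
    ext A
    simp only [Finset.mem_filter, Finset.card_eq_zero, Finset.mem_singleton, mem_indepSets]
    exact ⟨fun h => h.2, by rintro rfl; simp⟩
  rw [this]; simp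

theorem log_eval_indepPoly_le {V : Type*} [Fintype V] (G : SimpleGraph V) [G.LocallyFinite] {d : ℕ}
    (hd : 1 ≤ d) (hG : G.IsRegularOfDegree d) {x : ℝ} (hx : 0 < x) :
    Real.log ((indepPoly G).eval x) ≤ Fintype.card V / (2 * d) *
      Real.log ((indepPoly (completeBipartiteGraph (Fin d) (Fin d))).eval x) := by
  refine log_eval_le_of_log_derivative_le (coeff_indepPoly_nonneg _) (coeff_zero_indepPoly _)
    (coeff_indepPoly_nonneg _) (coeff_zero_indepPoly _) (fun y hy => ?_) hx
  rw [indepPoly_completeBipartiteGraph]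
  exact indepPoly_log_derivative_le G hd (card_filter_adj_eq hG) hy

theorem one_le_coeff_indepPoly {d k : ℕ} (hk : k ≤ d) :
    1 ≤ (indepPoly (completeBipartiteGraph (Fin d) (Fin d))).coeff k := by
  have h : (1 : ℝ) ≤ d.choose k := by exact_mod_cast Nat.choose_pos hk
  rw [indepPoly_completeBipartiteGraph, coeff_sub, ← C_ofNat, coeff_C_mul, coeff_one_add_X_pow,
    coeff_one]
  split_ifs <;> linarith

theorem natDegree_indepPoly_le (d : ℕ) :
    (indepPoly (completeBipartiteGraph (Fin d) (Fin d))).natDegree ≤ d := by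
  rw [indepPoly_completeBipartiteGraph]
  compute_degree

theorem log_eval_pow_card_le {p : ℝ[X]} {d n : ℕ} (hd : 1 ≤ d) (h : 2 * d ∣ n) (x : ℝ) :
    Real.log ((p ^ (n / (2 * d))).eval x) ≤ n / (2 * d) * Real.log (p.eval x) := by
  rw [eval_pow, Real.log_pow, Nat.cast_div h (by positivity)]
  push_cast
  rfl

theorem unionKdd_adj {d n : ℕ} (x y : Fin (n / (2 * d)) × (Fin d ⊕ Fin d)) :
    (unionKdd d n).Adj x y ↔ x.1 = y.1 ∧ (completeBipartiteGraph (Fin d) (Fin d)).Adj x.2 y.2 :=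
  Iff.rfl

end RegularEntropy


open RegularEntropy in
theorem mainTheorem5 (d : ℕ) (hd : 1 ≤ d) (ρ : ℝ) (hρ : ρ ∈ Set.Icc (0 : ℝ) (1 / 2)) :
    (∃ h : ℝ,
      Tendsto (fun n : ℕ =>
          RegularEntropy.logRate
            (RegularEntropy.numMatchings (RegularEntropy.unionKdd d n) ⌊ρ * (n : ℝ)⌋₊) n)
        (RegularEntropy.atTopDvd d) (𝓝 (h : EReal)) ∧
      ∀ (V : ℕ → Type*) [∀ j, Fintype (V j)] (G : ∀ j, SimpleGraph (V j))
        [∀ j, (G j).LocallyFinite],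
        (∀ j, (G j).IsRegularOfDegree d) →
        Tendsto (fun j => Fintype.card (V j)) atTop atTop →
        RegularEntropy.monomerEntropy G ρ ≤ (h : EReal)) ∧
    (∃ h : ℝ,
      Tendsto (fun n : ℕ =>
          RegularEntropy.logRate
            (RegularEntropy.numIndepSets (RegularEntropy.unionKdd d n) ⌊ρ * (n : ℝ)⌋₊) n)
        (RegularEntropy.atTopDvd d) (𝓝 (h : EReal)) ∧
      ∀ (V : ℕ → Type*) [∀ j, Fintype (V j)] (G : ∀ j, SimpleGraph (V j))
        [∀ j, (G j).LocallyFinite],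
        (∀ j, (G j).IsRegularOfDegree d) →
        Tendsto (fun j => Fintype.card (V j)) atTop atTop →
        RegularEntropy.indepSetEntropy G ρ ≤ (h : EReal)) := by
  obtain ⟨hρ0, hρ1⟩ := hρ
  have hd' : (1 : ℝ) ≤ d := by exact_mod_cast hd
  -- With `n = 2dN` vertices the index `ρ * n` is `μ * N` for `μ = 2 * d * ρ`, and `ρ ≤ 1/2` means
  -- `μ ≤ d`.
  have hμ0 : 0 ≤ 2 * d * ρ := by positivity
  have hμ : 2 * d * ρ ≤ d := by nlinarith
  have hdiv : ∀ N, 2 * d * N / (2 * d) = N := fun N => Nat.mul_div_cancel_left N (by omega)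
  constructor
  · have hcoeff := coeff_matchPoly_nonneg (completeBipartiteGraph (Fin d) (Fin d))
    have hone : ∀ i ≤ d, _ := fun i hi => one_le_coeff_matchPoly hi
    have hunion : ∀ n, matchPoly (unionKdd d n) =
        matchPoly (completeBipartiteGraph (Fin d) (Fin d)) ^ (n / (2 * d)) := fun n => by
      rw [matchPoly_prod _ _ unionKdd_adj, Fintype.card_fin]
    obtain ⟨h, hh, hl⟩ := exists_growth_rate (natDegree_matchPoly_le hd) hcoeff hone hμ0 hμ
    refine ⟨h / (2 * d), tendsto_logRate_unionKdd hρ0 hh hl hcoeff hone hρ1 hd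
      (c := fun n k => numMatchings (unionKdd d n) k)
      (fun n k hn hpos x hx => ?_) (fun N k => ?_), fun V _ G _ hG hV => ?_⟩
    · exact log_add_mul_log_le (coeff_matchPoly_nonneg _) (coeff_matchPoly _ _) hpos hx
        (hunion n ▸ log_eval_pow_card_le hd hn x)
    · rw [← coeff_matchPoly, hunion, hdiv]
    · exact iSup_limsup_logRate_le hh hd (c := fun j k => numMatchings (G j) k) hV
        fun j k hpos x hx => log_add_mul_log_le (coeff_matchPoly_nonneg _) (coeff_matchPoly _ _)
          hpos hx (log_eval_matchPoly_le (G j) hd (hG j) hx)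
  · have hcoeff := coeff_indepPoly_nonneg (completeBipartiteGraph (Fin d) (Fin d))
    have hone : ∀ i ≤ d, _ := fun i hi => one_le_coeff_indepPoly hi
    have hunion : ∀ n, indepPoly (unionKdd d n) =
        indepPoly (completeBipartiteGraph (Fin d) (Fin d)) ^ (n / (2 * d)) := fun n => by
      rw [indepPoly_prod _ _ unionKdd_adj, Fintype.card_fin]
    obtain ⟨h, hh, hl⟩ := exists_growth_rate (natDegree_indepPoly_le d) hcoeff hone hμ0 hμ
    refine ⟨h / (2 * d), tendsto_logRate_unionKdd hρ0 hh hl hcoeff hone hρ1 hd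
      (c := fun n k => numIndepSets (unionKdd d n) k)
      (fun n k hn hpos x hx => ?_) (fun N k => ?_), fun V _ G _ hG hV => ?_⟩
    · exact log_add_mul_log_le (coeff_indepPoly_nonneg _) (coeff_indepPoly _ _) hpos hx
        (hunion n ▸ log_eval_pow_card_le hd hn x)
    · rw [← coeff_indepPoly, hunion, hdiv]
    · exact iSup_limsup_logRate_le hh hd (c := fun j k => numIndepSets (G j) k) hV
        fun j k hpos x hx => log_add_mul_log_le (coeff_indepPoly_nonneg _) (coeff_indepPoly _ _)
          hpos hx (log_eval_indepPoly_le (G j) hd (hG j) hx)
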